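/- Let $\Omega=[0,2\pi]^2$ with periodic boundary conditions and $\widehat f(k)=(2\pi)^{-2}\int_\Omega f(x)e^{-ik\cdot x}\,dx$ for $k\in\mathbb Z^2$. Write $|f|_2=\left(\int_\Omega |f|^2dx\right)^{1/2}$, $\widehat{\Lambda^s f}(k)=|k|^s\widehat f(k)$ and $\|f\|_s=|\Lambda^s f|_2$, and let $H^s$ be the space of all real $f\in L^2(\Omega)$ with $\|f\|_s<\infty$. For a function $\theta$ put $u=(-\mathcal R_2\theta,\mathcal R_1\theta)$, where $\mathcal R_j$ is the periodic Riesz transform with symbol $-ik_j/|k|$ for $k\neq 0$ (and $0$ at $k=0$). Let $0<\alpha\le 1$ and $s\ge 3$. For $\mu>0$ consider the regularized quasi-geostrophic equation $$\theta_t+u\cdot\nabla\theta+\mu(-\Delta)^\alpha\theta_t=0 \qquad (1)$$ and the quasi-geostrophic (QG) equation $$\theta_t+u\cdot\nabla\theta=0. \qquad (2)$$ A solution on $[0,T]$ with initial value $\theta_0\in H^s$ means a solution $\theta\in L^\infty([0,T];H^s)$, where the equation is tested with $e^{-ik\cdot x}$ for every $k\in\mathbb Z^2$ and integrated in time from the initial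 value $\theta_0$. (a) For every $\alpha_0>0$ there is a constant $C>0$, depending only on $\alpha_0$, such that the following holds for all $\alpha\in[\alpha_0,1]$, $s\ge3$, $\mu>0$ and $T>0$. If $\theta_0^\mu,\theta_0\in H^s$, $\theta^\mu$ is a solution of (1) on $[0,T]$ with initial value $\theta_0^\mu$, and $\theta$ is a solution of (2) on $[0,T]$ with initial value $\theta_0$, then for all $0\le t\le T$ $$|\theta^\mu(\cdot,t)-\theta(\cdot,t)|_2^2+\mu\|\theta^\mu(\cdot,t)-\theta(\cdot,t)\|_\alpha^2$$ $$\le\left(|\theta_0^\mu-\theta_0|_2^2+\mu\|\theta_0^\mu-\theta_0\|_\alpha^2\right)\exp\left[C\int_0^t(1+\|\theta(\cdot,\tau)\|_s)\,d\tau\right]$$ $$+\,C\mu^2\int_0^t\exp\left[C\int_\zeta^t(1+\|\theta(\cdot,\tau)\|_s)\,d\tau\right]\|\theta(\cdot,\zeta)\|_{2\alpha+1}^4\,d\zeta .$$ (b) In particular, let $T>0$, let $\theta$ be a solution of (2) on $[0,T]$ with initial value $\theta_0\in H^s$, let $\mu_1>0$, and for $0<\mu<\mu_1$ let $\theta^\mu$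 be a solution of (1) on $[0,T]$ with initial value $\theta_0^\mu\in H^s$. Suppose that for a constant $K$ $$|\theta_0^\mu-\theta_0|_2^2+\mu\|\theta_0^\mu-\theta_0\|_\alpha^2\le K\mu^2\qquad\text{for all }0<\mu<\mu_1 .$$ Then $$|\theta^\mu(\cdot,t)-\theta(\cdot,t)|_2^2+\mu\|\theta^\mu(\cdot,t)-\theta(\cdot,t)\|_\alpha^2\le C\mu^2\qquad\text{for all }0<\mu<\mu_1,\ 0\le t\le T,$$ where, given any lower bound $\alpha_0>0$ for $\alpha$: (b1) $C$ depends only on $\alpha_0$, $T$, $K$ and an upper bound for $\sup_{0\le t\le T}\|\theta(\cdot,t)\|_s$; (b2) if $T$ lies within the time of existence guaranteed by the size of the initial value, that is, if $\|\theta_0\|_s\le R$ and $TR\le c$ with a certain $c>0$ that depends only on $s$, then $C$ can be chosen to depend only on $\alpha_0$, $s$, $K$, $T$ and $R$. -/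

import Mathlib

open MeasureTheory Set

noncomputable section

namespace QG

instance factPeriodPos : Fact (0 < 2 * Real.pi) := ⟨Real.two_pi_pos⟩

/-- The period box with opposite sides identified, i.e. the torus of side `2π`. Functions on it are
the functions on the plane with period `2π` in each variable; `volume` is Lebesgue measure, with
total mass `(2π)²`. -/
abbrev Box : Type := Fin 2 → AddCircle (2 * Real.pi)

/-- Frequencies, `k = (k₁, k₂)` in `ℤ²` (here `k 0` is `k₁` and `k 1` is `k₂`). -/
abbrev Freq : Type := Fin 2 → ℤ

/-- The Euclidean length of a frequency. -/
def len (k : Freq) : ℝ := Real.sqrt ((k 0 : ℝ) ^ 2 + (k 1 : ℝ) ^ 2)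

/-- The character `x ↦ exp (i k · x)`. -/
def char (k : Freq) (x : Box) : ℂ := ∏ j, fourier (k j) (x j)

/-- The Fourier coefficient `(2π)⁻² ∫ f(x) exp (-i k · x) dx`. -/
def coeff (f : Box → ℂ) (k : Freq) : ℂ :=
  (1 / ((2 * Real.pi) ^ 2 : ℝ) : ℂ) * ∫ x, f x * char (-k) x

/-- Fourier coefficients of a real-valued function. -/
def rcoeff (f : Box → ℝ) (k : Freq) : ℂ := coeff (fun x => (f x : ℂ)) k

/-- The norm of `L²` over the period box. -/
def l2norm (f : Box → ℝ) : ℝ := Real.sqrt (∫ x, f x ^ 2)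

/-- The homogeneous Sobolev (semi)norm `‖f‖_s = |Λ^s f|_2`, where `Λ^s` multiplies the `k`-th
Fourier coefficient by `|k|^s`. The factor `(2π)²` is Parseval's, for the `L²` norm above. -/
def sobNorm (s : ℝ) (f : Box → ℝ) : ℝ :=
  Real.sqrt ((2 * Real.pi) ^ 2 * ∑' k : Freq, len k ^ (2 * s) * ‖rcoeff f k‖ ^ 2)

/-- Membership in the Sobolev space `H^s` (for `s ≥ 0`). -/
def MemHs (s : ℝ) (f : Box → ℝ) : Prop :=
  MemLp f 2 volume ∧ Summable fun k : Freq => len k ^ (2 * s) * ‖rcoeff f k‖ ^ 2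

/-- The Fourier multiplier operator with symbol `m`, as the sum of a Fourier series. It is applied
below only with `‖m k‖ ≤ |k|` or `‖m k‖ ≤ 1`, and to `f` in `H^s` with `s ≥ 3`, where the series
converges absolutely. -/
def multiplier (m : Freq → ℂ) (f : Box → ℝ) (x : Box) : ℂ :=
  ∑' k : Freq, m k * rcoeff f k * char k x

/-- The partial derivative of `f` in the `j`-th variable. -/
def partialDeriv (j : Fin 2) (f : Box → ℝ) : Box → ℂ :=
  multiplier (fun k => Complex.I * (k j : ℂ)) f

/-- The `j`-th periodic Riesz transform, with symbol `-i k_j / |k|` for `k ≠ 0` and `0` for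
`k = 0`. -/
def riesz (j : Fin 2) (f : Box → ℝ) : Box → ℂ :=
  multiplier (fun k => -Complex.I * ((k j : ℂ) / (len k : ℂ))) f

/-- The nonlinear term `u · ∇θ` with the velocity `u = (-R₂ θ, R₁ θ)`. -/
def advection (f : Box → ℝ) (x : Box) : ℂ :=
  (-riesz 1 f x) * partialDeriv 0 f x + riesz 0 f x * partialDeriv 1 f x

/-- `θ` is a solution in `L^∞([0,T]; H^s)` of the regularized quasi-geostrophic equation
`θ_t + u · ∇θ + μ (-Δ)^α θ_t = 0` with initial value `θ₀`: the equation is tested with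
every exponential `exp (-i k · x)` and integrated in time. -/
structure IsRegularizedSolution (μ α s T : ℝ) (θ₀ : Box → ℝ) (θ : ℝ → Box → ℝ) : Prop where
  memHs : ∀ t ∈ Icc 0 T, MemHs s (θ t)
  bounded : ∃ M : ℝ, ∀ t ∈ Icc 0 T, sobNorm s (θ t) ≤ M
  integrable : ∀ k, IntervalIntegrable (fun τ => coeff (advection (θ τ)) k) volume 0 T
  equation : ∀ t ∈ Icc 0 T, ∀ k,
    ((1 + μ * len k ^ (2 * α) : ℝ) : ℂ) * (rcoeff (θ t) k - rcoeff θ₀ k)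
      + ∫ τ in (0 : ℝ)..t, coeff (advection (θ τ)) k = 0

/-- `θ` is a solution in `L^∞([0,T]; H^s)` of the quasi-geostrophic equation
`θ_t + u · ∇θ = 0` with initial value `θ₀`, in the same sense. -/
structure IsQGSolution (s T : ℝ) (θ₀ : Box → ℝ) (θ : ℝ → Box → ℝ) : Prop where
  memHs : ∀ t ∈ Icc 0 T, MemHs s (θ t)
  bounded : ∃ M : ℝ, ∀ t ∈ Icc 0 T, sobNorm s (θ t) ≤ M
  integrable : ∀ k, IntervalIntegrable (fun τ => coeff (advection (θ τ)) k) volume 0 T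
  equation : ∀ t ∈ Icc 0 T, ∀ k,
    (rcoeff (θ t) k - rcoeff θ₀ k) + ∫ τ in (0 : ℝ)..t, coeff (advection (θ τ)) k = 0

/-- The squared distance `|f - g|_2² + μ ‖f - g‖_α²`. -/
def gap (μ α : ℝ) (f g : Box → ℝ) : ℝ :=
  l2norm (fun x => f x - g x) ^ 2 + μ * sobNorm α (fun x => f x - g x) ^ 2

end QG

end

noncomputable section

namespace QG

/-! ### Frequencies -/

/-! The argument is an energy estimate carried out on Fourier coefficients. Let `a`, `b` be the
coefficients of θ^μ and θ, `w = a - b` and `p k = 1 + μ|k|^(2α)`. The two equations combine to `p w'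
= -adv a a + p · adv b b`, and `gap` is `(2π)² ∑ p |w|²`, so pairing with `w` gives its derivative.
Two terms result. The difference `adv a a - adv b b` contributes `tri a w w + tri w b w`. The
transport part `tri a w w` vanishes because the velocity is divergence free (`tri_self`), so no norm
of θ^μ enters; the other part costs only the ℓ¹ norm of `|k| b`, which H³ controls
(`norm_tri_le_of_lipschitz`). The term `μ|k|^(2α) adv b b` involves only θ besides `w`
(`tri_viscous`). It is paired with `w` in the plain L² norm, so completing the square leaves a
multiple of |w|² and a source of order μ²‖θ‖⁴ with index 2α+1: this is the rate μ²
(`difference_rate`). Grönwall's inequality (`gronwall_integral`) gives (a). The lower bound on α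
makes the lattice sum of |k|^(-2(2α+1)) uniformly bounded, and (b1) follows because 2α+1 ≤ 3 ≤ s.
For (b2), ‖θ‖_s must be controlled by its initial size. A commutator estimate gives `z ≤ z₀ + C ∫
z^(3/2)` for `z = ‖θ‖_s²`, which bounds `z` on a time inversely proportional to the initial norm
(`sq_le_of_integral_cube`). A solution in L^∞H^s is too rough to pair the equation with Λ^(2s)θ, so
the weight |k|^s is truncated, the estimate is proved uniformly in the cutoff
(`norm_tri_cutWeight_le`), and the cutoff is then removed (`CoeffSolution.hs_sq_le`). Exchanges of
sums and integrals rest on the cubic decay of coefficients that H³ provides. The decay constants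
serve only convergence and do not appear in the final estimates. -/

lemma len_eq_norm (k : Freq) : len k = ‖((k 0 : ℝ) : ℂ) + ((k 1 : ℝ) : ℂ) * Complex.I‖ := by
  rw [Complex.norm_add_mul_I, len]

lemma len_nonneg (k : Freq) : 0 ≤ len k := Real.sqrt_nonneg _

@[simp] lemma len_zero : len 0 = 0 := by simp [len]

@[simp] lemma len_neg (k : Freq) : len (-k) = len k := by simp [len]

lemma len_add_le (k l : Freq) : len (k + l) ≤ len k + len l := by
  simp only [len_eq_norm, Pi.add_apply]
  refine le_trans (le_of_eq ?_) (norm_add_le _ _)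
  congr 1
  push_cast
  ring

lemma abs_len_sub_len_le (m n : Freq) : |len (m + n) - len n| ≤ len m := by
  rw [abs_le]
  constructor
  · have := len_add_le (m + n) (-m)
    simp only [add_neg_cancel_comm, len_neg] at this
    linarith
  · linarith [len_add_le m n]

lemma abs_coord_le_len (k : Freq) (j : Fin 2) : |(k j : ℝ)| ≤ len k := by
  apply Real.abs_le_sqrt
  fin_cases j <;> simp <;> positivity

lemma one_le_len {k : Freq} (hk : k ≠ 0) : 1 ≤ len k := by
  obtain ⟨j, hj⟩ := Function.ne_iff.1 hk
  refine le_trans ?_ (abs_coord_le_len k j)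
  exact_mod_cast Int.one_le_abs hj

lemma len_pos {k : Freq} (hk : k ≠ 0) : 0 < len k := one_pos.trans_le (one_le_len hk)

lemma norm_le_len (k : Freq) : ‖k‖ ≤ len k := by
  refine (pi_norm_le_iff_of_nonneg (len_nonneg k)).2 fun j => ?_
  simpa [Int.norm_eq_abs] using abs_coord_le_len k j

/-- The Euclidean length dominates the sup norm, whose lattice sums are known from Eisenstein
series. The exponent 2 is the dimension. -/
lemma summable_len_rpow {r : ℝ} (hr : 2 < r) : Summable fun k : Freq => len k ^ (-r) := by
  refine Summable.of_nonneg_of_le (fun k => Real.rpow_nonneg (len_nonneg k) _) (fun k => ?_)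
    (EisensteinSeries.summable_one_div_norm_rpow hr)
  by_cases hk : k = 0
  · subst hk
    simp
  · exact Real.rpow_le_rpow_of_nonpos (norm_pos_iff.2 hk) (norm_le_len k) (by linarith)

lemma summable_inv_one_add_len_cube : Summable fun k : Freq => ((1 + len k) ^ 3)⁻¹ := by
  refine Summable.of_norm_bounded_eventually (summable_len_rpow (r := 3) (by norm_num)) ?_
  refine (Set.finite_singleton (0 : Freq)).subset fun k hk => ?_
  by_contra h0
  apply hk
  have hp := len_pos h0
  change ‖((1 + len k) ^ 3)⁻¹‖ ≤ len k ^ (-(3 : ℝ))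
  rw [Real.norm_of_nonneg (by positivity), Real.rpow_neg hp.le]
  norm_cast
  gcongr
  linarith

/-! ### Characters -/

lemma char_add (m n : Freq) (x : Box) : char (m + n) x = char m x * char n x := by
  simp only [char, Pi.add_apply, fourier_add, Finset.prod_mul_distrib]

lemma char_neg (m : Freq) (x : Box) : char (-m) x = (starRingEnd ℂ) (char m x) := by
  simp only [char, Pi.neg_apply, fourier_neg, map_prod]

@[simp] lemma norm_char (m : Freq) (x : Box) : ‖char m x‖ = 1 := by
  simp only [char, fourier_apply, norm_prod, Circle.norm_coe, Finset.prod_const_one]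

@[fun_prop] lemma continuous_char (m : Freq) : Continuous (char m) := by
  unfold char
  fun_prop

/-- The rescaling of the period box to the torus of side `1`. -/
def toUnitTorus : Box ≃ₜ UnitAddTorus (Fin 2) :=
  Homeomorph.piCongrRight fun _ =>
    AddCircle.homeomorphAddCircle (2 * Real.pi) 1 Real.two_pi_pos.ne' one_ne_zero

lemma toUnitTorus_add (x y : Box) : toUnitTorus (x + y) = toUnitTorus x + toUnitTorus y := by
  funext j
  exact map_add (AddCircle.equivAddCircle (2 * Real.pi) 1 Real.two_pi_pos.ne' one_ne_zero) _ _

lemma mFourier_toUnitTorus (k : Freq) (x : Box) :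
    UnitAddTorus.mFourier k (toUnitTorus x) = char k x := by
  simp only [UnitAddTorus.mFourier, ContinuousMap.coe_mk, char]
  refine Finset.prod_congr rfl fun j _ => ?_
  change fourier (k j) (AddCircle.homeomorphAddCircle (2 * Real.pi) 1 _ _ (x j)) = _
  induction x j using QuotientAddGroup.induction_on with
  | H y =>
    rw [AddCircle.homeomorphAddCircle_apply_mk, fourier_coe_apply, fourier_coe_apply]
    congr 1
    have : (Real.pi : ℂ) ≠ 0 := by exact_mod_cast Real.pi_ne_zero
    push_cast
    field_simp

/-- The normalized measure on the torus of side `1`. -/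
def unitTorusMeasure : Measure (UnitAddTorus (Fin 2)) :=
  Measure.pi fun _ => AddCircle.haarAddCircle

instance : IsProbabilityMeasure unitTorusMeasure := by
  unfold unitTorusMeasure; infer_instance

instance : unitTorusMeasure.IsAddHaarMeasure := by
  unfold unitTorusMeasure; infer_instance

/-- The rescaling is a topological group isomorphism, so the pushforward is again a Haar measure and
hence a multiple of the normalized one. The factor is read off from the total mass. -/
lemma map_toUnitTorus :
    (volume : Measure Box).map toUnitTorus =
      ENNReal.ofReal ((2 * Real.pi) ^ 2) • unitTorusMeasure := by
  let e : Box ≃+ UnitAddTorus (Fin 2) := { toUnitTorus.toEquiv with map_add' := toUnitTorus_add }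
  have h1 : ((volume : Measure Box).map toUnitTorus).IsAddHaarMeasure :=
    e.isAddHaarMeasure_map volume toUnitTorus.continuous toUnitTorus.symm.continuous
  rw [Measure.isAddLeftInvariant_eq_smul ((volume : Measure Box).map toUnitTorus)
    unitTorusMeasure]
  have h3 := congrArg (fun ν => ν univ) (Measure.isAddLeftInvariant_eq_smul
    ((volume : Measure Box).map toUnitTorus) unitTorusMeasure)
  have h4 : (volume : Measure Box) univ = ENNReal.ofReal (2 * Real.pi) ^ 2 := by
    rw [volume_pi, Measure.pi_univ]
    simp only [AddCircle.measure_univ, Finset.prod_const, Finset.card_univ, Fintype.card_fin]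
  rw [Measure.map_apply toUnitTorus.continuous.measurable MeasurableSet.univ, preimage_univ,
    h4] at h3
  simp only [Measure.smul_apply, measure_univ, ENNReal.smul_def, smul_eq_mul, mul_one] at h3
  rw [ENNReal.ofReal_pow Real.two_pi_pos.le, h3]
  rfl

lemma integral_comp_toUnitTorus (F : UnitAddTorus (Fin 2) → ℂ) :
    ∫ x, F (toUnitTorus x) = ((2 * Real.pi) ^ 2 : ℝ) * ∫ y, F y ∂unitTorusMeasure := by
  have h := toUnitTorus.measurableEmbedding.integral_map (μ := volume) F
  rw [← h, map_toUnitTorus, integral_smul_measure, ENNReal.toReal_ofReal (by positivity)]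
  simp

lemma integral_char (k : Freq) :
    ∫ x, char k x = if k = 0 then (((2 * Real.pi) ^ 2 : ℝ) : ℂ) else 0 := by
  have h := integral_comp_toUnitTorus fun y => UnitAddTorus.mFourier k y
  simp only [mFourier_toUnitTorus] at h
  rw [h]
  have h2 := orthonormal_iff_ite.1 (UnitAddTorus.orthonormal_mFourier (d := Fin 2)) 0 k
  rw [ContinuousMap.inner_toLp] at h2
  have h3 : ∫ y, UnitAddTorus.mFourier k y ∂unitTorusMeasure = if 0 = k then 1 else 0 := by
    rw [← h2]
    refine integral_congr_ae (Filter.Eventually.of_forall fun y => ?_)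
    simp [UnitAddTorus.mFourier_zero]
  rw [h3]
  by_cases hk : k = 0
  · simp [hk]
  · simp [hk, Ne.symm hk]

/-! ### Fourier coefficients of real functions -/

lemma memLp_ofReal {f : Box → ℝ} (hf : MemLp f 2 volume) :
    MemLp (fun x => (f x : ℂ)) 2 volume := hf.ofReal

lemma integrable_mul_char {f : Box → ℂ} (hf : Integrable f volume) (k : Freq) :
    Integrable (fun x => f x * char k x) volume :=
  hf.mul_bdd (c := 1) (continuous_char k).aestronglyMeasurable
    (Filter.Eventually.of_forall fun x => (norm_char k x).le)

lemma integrable_ofReal {f : Box → ℝ} (hf : MemLp f 2 volume) :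
    Integrable (fun x => (f x : ℂ)) volume :=
  (memLp_ofReal hf).integrable (by norm_num)

lemma rcoeff_sub {f g : Box → ℝ} (hf : MemLp f 2 volume) (hg : MemLp g 2 volume) (k : Freq) :
    rcoeff (fun x => f x - g x) k = rcoeff f k - rcoeff g k := by
  simp only [rcoeff, coeff, Complex.ofReal_sub, sub_mul]
  rw [integral_sub (integrable_mul_char (integrable_ofReal hf) _)
    (integrable_mul_char (integrable_ofReal hg) _), mul_sub]

lemma rcoeff_neg (f : Box → ℝ) (k : Freq) :
    rcoeff f (-k) = (starRingEnd ℂ) (rcoeff f k) := by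
  simp only [rcoeff, coeff, map_mul, ← integral_conj, Complex.conj_ofReal, char_neg,
    Complex.conj_conj, neg_neg]
  simp [map_ofNat]

/-- Parseval's identity on the unit torus, transported along `toUnitTorus`; the factor `(2π)²` is
the mass of the box. -/
lemma hasSum_norm_rcoeff_sq {f : Box → ℝ} (hf : MemLp f 2 volume) :
    HasSum (fun k => (2 * Real.pi) ^ 2 * ‖rcoeff f k‖ ^ 2) (∫ x, f x ^ 2) := by
  let g : UnitAddTorus (Fin 2) → ℂ := fun y => (f (toUnitTorus.symm y) : ℂ)
  have hg : MemLp g 2 unitTorusMeasure := by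
    have h1 : MemLp g 2 ((volume : Measure Box).map toUnitTorus) := by
      rw [toUnitTorus.measurableEmbedding.memLp_map_measure_iff]
      refine (memLp_ofReal hf).congr_norm ?_ ?_
      · simpa [g, Function.comp_def] using (memLp_ofReal hf).aestronglyMeasurable
      · simp [g]
    have h2 := h1.smul_measure (c := (ENNReal.ofReal ((2 * Real.pi) ^ 2))⁻¹)
      (by simp)
    rwa [map_toUnitTorus, smul_smul, ENNReal.inv_mul_cancel (by simp) (by simp),
      one_smul] at h2
  have hP : HasSum (fun k => ‖UnitAddTorus.mFourierCoeff (hg.toLp g) k‖ ^ 2)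
      (∫ y, ‖(hg.toLp g : UnitAddTorus (Fin 2) → ℂ) y‖ ^ 2 ∂unitTorusMeasure) :=
    UnitAddTorus.hasSum_sq_mFourierCoeff (hg.toLp g)
  have hc : ∀ k, UnitAddTorus.mFourierCoeff (hg.toLp g) k = rcoeff f k := by
    intro k
    have h1 : UnitAddTorus.mFourierCoeff (hg.toLp g) k =
        ∫ y, UnitAddTorus.mFourier (-k) y • g y ∂unitTorusMeasure :=
      integral_congr_ae (hg.coeFn_toLp.mono fun y hy => by simp only [hy])
    have h2 := integral_comp_toUnitTorus fun y => UnitAddTorus.mFourier (-k) y • g y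
    rw [h1, rcoeff, coeff]
    simp only [mFourier_toUnitTorus, g, Homeomorph.symm_apply_apply, smul_eq_mul] at h2 ⊢
    simp only [mul_comm _ (char (-k) _)]
    rw [h2, ← mul_assoc, one_div, inv_mul_cancel₀, one_mul]
    exact_mod_cast (by positivity : (2 * Real.pi) ^ 2 ≠ 0)
  simp only [hc] at hP
  have hI : (2 * Real.pi) ^ 2 * ∫ y, ‖(hg.toLp g : UnitAddTorus (Fin 2) → ℂ) y‖ ^ 2
      ∂unitTorusMeasure = ∫ x, f x ^ 2 := by
    have h1 : ∫ y, ‖(hg.toLp g : UnitAddTorus (Fin 2) → ℂ) y‖ ^ 2 ∂unitTorusMeasure =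
        ∫ y, (f (toUnitTorus.symm y)) ^ 2 ∂unitTorusMeasure :=
      integral_congr_ae (hg.coeFn_toLp.mono fun y hy => by simp only [hy]; simp [g])
    have h2 := toUnitTorus.measurableEmbedding.integral_map (μ := volume)
      fun y => (f (toUnitTorus.symm y)) ^ 2
    rw [map_toUnitTorus, integral_smul_measure, ENNReal.toReal_ofReal (by positivity)] at h2
    rw [h1]
    simpa using h2
  rw [← hI]
  exact hP.mul_left _

/-! ### The nonlinear term in Fourier space -/

/-- The symbol of the nonlinear term. -/
def adKer (m n : Freq) : ℝ := ((m 0 : ℝ) * n 1 - m 1 * n 0) / len m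

/-- The `k`-th Fourier coefficient of `u · ∇ g` where `u` is the velocity belonging to `f`. -/
def adv (f g : Freq → ℂ) (k : Freq) : ℂ := ∑' m, (adKer m (k - m) : ℂ) * f m * g (k - m)

/-- Absolute convergence allows the double series to be integrated term by term, and orthogonality
of the characters keeps only the pairs whose frequencies add up to `k`. -/
lemma coeff_mul_of_summable {c d : Freq → ℂ} (hc : Summable fun k => ‖c k‖)
    (hd : Summable fun k => ‖d k‖) (k : Freq) :
    coeff (fun x => (∑' m, c m * char m x) * ∑' n, d n * char n x) k =
      ∑' m, c m * d (k - m) := by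
  have hs : Summable fun p : Freq × Freq => ‖c p.1‖ * ‖d p.2‖ :=
    hc.mul_of_nonneg hd (fun _ => norm_nonneg _) fun _ => norm_nonneg _
  have h1 : ∀ x, (∑' m, c m * char m x) * (∑' n, d n * char n x) * char (-k) x =
      ∑' p : Freq × Freq, c p.1 * d p.2 * char (p.1 + p.2 - k) x := by
    intro x
    rw [tsum_mul_tsum_of_summable_norm (by simpa using hc) (by simpa using hd), ← tsum_mul_right]
    refine tsum_congr fun p => ?_
    rw [sub_eq_add_neg, char_add, char_add]
    ring
  have h2 : ∫ x, ∑' p : Freq × Freq, c p.1 * d p.2 * char (p.1 + p.2 - k) x =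
      ∑' p : Freq × Freq, ∫ x, c p.1 * d p.2 * char (p.1 + p.2 - k) x := by
    refine (integral_tsum_of_summable_integral_norm (fun p => ?_) ?_).symm
    · exact Continuous.integrable_of_hasCompactSupport (by fun_prop)
        (HasCompactSupport.of_compactSpace _)
    · simp only [norm_mul, norm_char, mul_one, integral_const, smul_eq_mul]
      exact hs.mul_left _
  have h3 : ∀ p : Freq × Freq, ∫ x, c p.1 * d p.2 * char (p.1 + p.2 - k) x =
      (((2 * Real.pi) ^ 2 : ℝ) : ℂ) * if p.2 = k - p.1 then c p.1 * d p.2 else 0 := by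
    intro p
    rw [integral_const_mul, integral_char]
    by_cases h : p.2 = k - p.1
    · rw [if_pos (by rw [h]; abel), if_pos h]
      ring
    · rw [if_neg (fun h' => h (by rw [eq_sub_iff_add_eq']; exact sub_eq_zero.1 h')), if_neg h]
      ring
  have h4 : Summable fun p : Freq × Freq => if p.2 = k - p.1 then c p.1 * d p.2 else 0 := by
    refine Summable.of_norm_bounded hs fun p => ?_
    split_ifs
    · simp
    · simp only [norm_zero]; positivity
  simp only [coeff, h1]
  rw [h2, tsum_congr h3, tsum_mul_left, ← mul_assoc, one_div, inv_mul_cancel₀, one_mul,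
    h4.tsum_prod]
  · exact tsum_congr fun m => tsum_ite_eq (k - m) _
  · exact_mod_cast (by positivity : (2 * Real.pi) ^ 2 ≠ 0)

lemma continuous_charSeries {c : Freq → ℂ} (hc : Summable fun k => ‖c k‖) :
    Continuous fun x => ∑' m, c m * char m x :=
  continuous_tsum (fun m => by fun_prop) hc fun m x => by simp

lemma summable_mul_sub {c d : Freq → ℂ} (hc : Summable fun k => ‖c k‖)
    (hd : Summable fun k => ‖d k‖) (k : Freq) : Summable fun m => c m * d (k - m) := by
  refine Summable.of_norm_bounded (hc.mul_right (∑' n, ‖d n‖)) fun m => ?_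
  rw [norm_mul]
  gcongr
  exact hd.le_tsum (k - m) fun _ _ => norm_nonneg _

lemma coeff_add {F G : Box → ℂ} (hF : Integrable F volume) (hG : Integrable G volume) (k : Freq) :
    coeff (fun x => F x + G x) k = coeff F k + coeff G k := by
  simp only [coeff, add_mul]
  rw [integral_add (integrable_mul_char hF _) (integrable_mul_char hG _), mul_add]

lemma coeff_advection {f : Box → ℝ} (hf : Summable fun k => (1 + len k) * ‖rcoeff f k‖)
    (k : Freq) : coeff (advection f) k = adv (rcoeff f) (rcoeff f) k := by
  have hr : ∀ j, Summable fun k => ‖-Complex.I * ((k j : ℂ) / (len k : ℂ)) * rcoeff f k‖ := by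
    intro j
    refine Summable.of_nonneg_of_le (fun _ => norm_nonneg _) (fun k => ?_) hf
    rw [norm_mul]
    gcongr
    rw [norm_mul, norm_neg, Complex.norm_I, one_mul, norm_div, Complex.norm_real,
      Real.norm_of_nonneg (len_nonneg k), Complex.norm_intCast]
    have := div_le_one_of_le₀ (abs_coord_le_len k j) (len_nonneg k)
    linarith [len_nonneg k]
  have hd : ∀ j, Summable fun k => ‖Complex.I * (k j : ℂ) * rcoeff f k‖ := by
    intro j
    refine Summable.of_nonneg_of_le (fun _ => norm_nonneg _) (fun k => ?_) hf
    rw [norm_mul]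
    gcongr
    rw [norm_mul, Complex.norm_I, one_mul, Complex.norm_intCast]
    linarith [abs_coord_le_len k j]
  have hint : ∀ {c d : Freq → ℂ}, (Summable fun k => ‖c k‖) → (Summable fun k => ‖d k‖) →
      Integrable (fun x => (∑' m, c m * char m x) * ∑' n, d n * char n x) volume :=
    fun hc hd => Continuous.integrable_of_hasCompactSupport
      ((continuous_charSeries hc).mul (continuous_charSeries hd))
      (HasCompactSupport.of_compactSpace _)
  have hr' : Summable fun k => ‖-(-Complex.I * ((k 1 : ℂ) / (len k : ℂ)) * rcoeff f k)‖ := by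
    simpa only [norm_neg] using hr 1
  have h1 : advection f = fun x =>
      (∑' m, -(-Complex.I * ((m 1 : ℂ) / (len m : ℂ)) * rcoeff f m) * char m x) *
          (∑' n, Complex.I * (n 0 : ℂ) * rcoeff f n * char n x) +
        (∑' m, -Complex.I * ((m 0 : ℂ) / (len m : ℂ)) * rcoeff f m * char m x) *
          (∑' n, Complex.I * (n 1 : ℂ) * rcoeff f n * char n x) := by
    funext x
    simp only [advection, riesz, partialDeriv, multiplier, ← tsum_neg, neg_mul]
  rw [h1, coeff_add (hint hr' (hd 0)) (hint (hr 0) (hd 1)), coeff_mul_of_summable hr' (hd 0),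
    coeff_mul_of_summable (hr 0) (hd 1), ← Summable.tsum_add (summable_mul_sub hr' (hd 0) k)
      (summable_mul_sub (hr 0) (hd 1) k), adv]
  refine tsum_congr fun m => ?_
  simp only [adKer]
  push_cast
  -- The factor `-i` of the Riesz symbol and the factor `i` of the derivative multiply to 1, which
  -- is why `adKer` is real.
  linear_combination (((m 1 : ℂ) / (len m : ℂ)) * ((k - m) 0 : ℤ) -
    ((m 0 : ℂ) / (len m : ℂ)) * ((k - m) 1 : ℤ)) * rcoeff f m * rcoeff f (k - m) *
      Complex.I_mul_I

/-! ### The symbol of the nonlinear term -/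

/-- The numerator is a planar cross product, at most `|m||n|`, and the Riesz symbol divides by
`|m|`. The velocity therefore costs no derivative; only the differentiated factor does. -/
lemma abs_adKer_le (m n : Freq) : |adKer m n| ≤ len n := by
  rw [adKer, abs_div, abs_of_nonneg (len_nonneg m)]
  refine div_le_of_le_mul₀ (len_nonneg m) (len_nonneg n) ?_
  rw [len, len, ← Real.sqrt_mul (by positivity)]
  apply Real.abs_le_sqrt
  nlinarith [sq_nonneg ((m 0 : ℝ) * n 0 + m 1 * n 1)]

/-- The cross product of `m` with itself vanishes; this is the divergence-free condition in Fourier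
variables. -/
lemma adKer_neg_add (m n : Freq) : adKer m (-(m + n)) = -adKer m n := by
  simp only [adKer, Pi.neg_apply, Pi.add_apply]
  push_cast
  ring

@[simp] lemma adKer_zero_left (n : Freq) : adKer 0 n = 0 := by simp [adKer]

@[simp] lemma adKer_zero_right (n : Freq) : adKer n 0 = 0 := by simp [adKer]

/-! ### Sequences with cubic decay -/

/-- The sequence `f` is bounded by `M (1 + |k|)⁻³`. -/
def Decay (M : ℝ) (f : Freq → ℂ) : Prop := ∀ k, ‖f k‖ ≤ M * ((1 + len k) ^ 3)⁻¹

lemma one_add_len_pos (k : Freq) : 0 < 1 + len k := by linarith [len_nonneg k]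

lemma Decay.nonneg {M : ℝ} {f : Freq → ℂ} (h : Decay M f) : 0 ≤ M := by
  simpa using (norm_nonneg _).trans (h 0)

lemma Decay.norm_le {M : ℝ} {f : Freq → ℂ} (h : Decay M f) (k : Freq) : ‖f k‖ ≤ M := by
  refine (h k).trans (mul_le_of_le_one_right h.nonneg (inv_le_one_of_one_le₀ ?_))
  exact one_le_pow₀ (by linarith [len_nonneg k])

lemma Decay.len_mul_norm_le {M : ℝ} {f : Freq → ℂ} (h : Decay M f) (k : Freq) :
    len k * ‖f k‖ ≤ M := by
  have h1 := one_add_len_pos k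
  have h2 := mul_le_mul_of_nonneg_left (h k) (len_nonneg k)
  refine h2.trans ?_
  rw [mul_left_comm]
  refine mul_le_of_le_one_right h.nonneg ?_
  rw [← div_eq_mul_inv, div_le_one (by positivity)]
  nlinarith [len_nonneg k, mul_nonneg (len_nonneg k) (len_nonneg k),
    pow_nonneg (len_nonneg k) 3]

lemma Decay.sub {A B : ℝ} {f g : Freq → ℂ} (hf : Decay A f) (hg : Decay B g) :
    Decay (A + B) fun k => f k - g k := fun k => by
  rw [add_mul]
  exact (norm_sub_le _ _).trans (add_le_add (hf k) (hg k))

lemma Decay.real_mul {A L : ℝ} {f : Freq → ℂ} {φ : Freq → ℝ} (hf : Decay A f)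
    (hφ : ∀ k, |φ k| ≤ L) : Decay (L * A) fun k => (φ k : ℂ) * f k := fun k => by
  rw [norm_mul, Complex.norm_real, mul_assoc]
  exact mul_le_mul (hφ k) (hf k) (norm_nonneg _) ((abs_nonneg _).trans (hφ k))

lemma Decay.summable {M : ℝ} {f : Freq → ℂ} (h : Decay M f) : Summable fun k => ‖f k‖ :=
  Summable.of_nonneg_of_le (fun _ => norm_nonneg _) h
    (summable_inv_one_add_len_cube.mul_left M)

lemma Decay.summable_sq {M : ℝ} {f : Freq → ℂ} (h : Decay M f) :
    Summable fun k => ‖f k‖ ^ 2 := by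
  refine Summable.of_nonneg_of_le (fun _ => by positivity) (fun k => ?_) (h.summable.mul_left M)
  rw [sq]
  exact mul_le_mul_of_nonneg_right (h.norm_le k) (norm_nonneg _)

/-! ### The trilinear form -/

/-- The pairing of `adv f g` with `h`, as a double sum. -/
def tri (f g h : Freq → ℂ) : ℂ :=
  ∑' p : Freq × Freq, (adKer p.1 p.2 : ℂ) * f p.1 * g p.2 * (starRingEnd ℂ) (h (p.1 + p.2))

/-- The change of variables `(m, n) ↦ (m + n, m)`. -/
def addPair : Freq × Freq ≃ Freq × Freq where
  toFun p := (p.1 + p.2, p.1)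
  invFun q := (q.2, q.1 - q.2)
  left_inv p := by simp
  right_inv q := by simp

lemma hasSum_adv_mul_conj {f g h : Freq → ℂ}
    (hs : Summable fun p : Freq × Freq =>
      (adKer p.1 p.2 : ℂ) * f p.1 * g p.2 * (starRingEnd ℂ) (h (p.1 + p.2)))
    (hk : ∀ k, Summable fun m => (adKer m (k - m) : ℂ) * f m * g (k - m)) :
    HasSum (fun k => adv f g k * (starRingEnd ℂ) (h k)) (tri f g h) := by
  have h1 := (addPair.symm.hasSum_iff (f := fun p : Freq × Freq =>
      (adKer p.1 p.2 : ℂ) * f p.1 * g p.2 * (starRingEnd ℂ) (h (p.1 + p.2)))).2 hs.hasSum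
  refine h1.prod_fiberwise fun k => ?_
  simpa [addPair, Function.comp_def, adv] using (hk k).hasSum.mul_right ((starRingEnd ℂ) (h k))

lemma norm_tri_term (f g h : Freq → ℂ) (p : Freq × Freq) :
    ‖(adKer p.1 p.2 : ℂ) * f p.1 * g p.2 * (starRingEnd ℂ) (h (p.1 + p.2))‖ =
      |adKer p.1 p.2| * ‖f p.1‖ * ‖g p.2‖ * ‖h (p.1 + p.2)‖ := by
  simp

lemma summable_adv_term {A B : ℝ} {f g : Freq → ℂ} (hf : Decay A f) (hg : Decay B g) (k : Freq) :
    Summable fun m => (adKer m (k - m) : ℂ) * f m * g (k - m) := by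
  refine Summable.of_norm_bounded (hf.summable.mul_right B) fun m => ?_
  rw [norm_mul, norm_mul, Complex.norm_real, Real.norm_eq_abs]
  calc |adKer m (k - m)| * ‖f m‖ * ‖g (k - m)‖ ≤ len (k - m) * ‖f m‖ * ‖g (k - m)‖ := by
        gcongr; exact abs_adKer_le _ _
    _ = ‖f m‖ * (len (k - m) * ‖g (k - m)‖) := by ring
    _ ≤ ‖f m‖ * B := by gcongr; exact hg.len_mul_norm_le _

lemma summable_tri {A B C : ℝ} {f g h : Freq → ℂ} (hf : Decay A f) (hg : Decay B g)
    (hh : Decay C h) : Summable fun p : Freq × Freq =>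
      (adKer p.1 p.2 : ℂ) * f p.1 * g p.2 * (starRingEnd ℂ) (h (p.1 + p.2)) := by
  have h1 : Summable fun q : Freq × Freq => ‖h q.1‖ * ‖f q.2‖ :=
    hh.summable.mul_of_nonneg hf.summable (fun _ => norm_nonneg _) fun _ => norm_nonneg _
  have h2 := (addPair.summable_iff.2 h1).mul_left B
  refine Summable.of_norm_bounded h2 fun p => ?_
  rw [norm_tri_term]
  simp only [addPair, Equiv.coe_fn_mk, Function.comp_apply]
  calc |adKer p.1 p.2| * ‖f p.1‖ * ‖g p.2‖ * ‖h (p.1 + p.2)‖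
      ≤ len p.2 * ‖f p.1‖ * ‖g p.2‖ * ‖h (p.1 + p.2)‖ := by gcongr; exact abs_adKer_le _ _
    _ = (len p.2 * ‖g p.2‖) * (‖h (p.1 + p.2)‖ * ‖f p.1‖) := by ring
    _ ≤ B * (‖h (p.1 + p.2)‖ * ‖f p.1‖) := by gcongr; exact hg.len_mul_norm_le _

lemma hasSum_adv_mul_conj_of_decay {A B C : ℝ} {f g h : Freq → ℂ} (hf : Decay A f)
    (hg : Decay B g) (hh : Decay C h) :
    HasSum (fun k => adv f g k * (starRingEnd ℂ) (h k)) (tri f g h) :=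
  hasSum_adv_mul_conj (summable_tri hf hg hh) (summable_adv_term hf hg)

/-- The reflection `(m, n) ↦ (m, -(m + n))`. -/
def reflectPair : Freq × Freq ≃ Freq × Freq where
  toFun p := (p.1, -(p.1 + p.2))
  invFun p := (p.1, -(p.1 + p.2))
  left_inv p := by simp
  right_inv p := by simp

/-- Under `(m, n) ↦ (m, -(m + n))` the product of `g n` with the conjugate of `g (m + n)` is
unchanged when `g` comes from a real function, while the kernel changes sign. Transport by a
divergence-free field is thus skew-symmetric. No summability is needed, since reindexing and
negation hold for every `tsum`. -/
lemma tri_self {f g : Freq → ℂ} (hg : ∀ k, g (-k) = (starRingEnd ℂ) (g k)) : tri f g g = 0 := by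
  have h1 : tri f g g = -tri f g g := by
    conv_lhs => rw [tri, ← reflectPair.tsum_eq]
    rw [tri, ← tsum_neg]
    refine tsum_congr fun p => ?_
    simp only [reflectPair, Equiv.coe_fn_mk, adKer_neg_add]
    rw [show p.1 + -(p.1 + p.2) = -p.2 by abel, hg, hg, Complex.conj_conj]
    push_cast
    ring
  exact self_eq_neg.1 h1

/-! ### Young's inequality for the trilinear form -/

lemma tsum_mul_le_sqrt_mul_sqrt {ι : Type*} {f g : ι → ℝ} (hf0 : ∀ i, 0 ≤ f i) (hg0 : ∀ i, 0 ≤ g i)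
    (hf : Summable fun i => f i ^ 2) (hg : Summable fun i => g i ^ 2) :
    (Summable fun i => f i * g i) ∧
      ∑' i, f i * g i ≤ √(∑' i, f i ^ 2) * √(∑' i, g i ^ 2) := by
  have h := Real.summable_and_inner_le_Lp_mul_Lq_tsum_of_nonneg (p := 2) (q := 2)
    (by constructor <;> norm_num) hf0 hg0 (by simpa using hf) (by simpa using hg)
  simpa [Real.sqrt_eq_rpow] using h

/-- Cauchy–Schwarz in `n` for fixed `m`, with translation invariance of the ℓ² norm, followed by
summation over `m`. -/
lemma young_left {f g h : Freq → ℝ} (hf0 : ∀ k, 0 ≤ f k) (hg0 : ∀ k, 0 ≤ g k)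
    (hh0 : ∀ k, 0 ≤ h k) (hf : Summable f) (hg : Summable fun k => g k ^ 2)
    (hh : Summable fun k => h k ^ 2) :
    (Summable fun p : Freq × Freq => f p.1 * g p.2 * h (p.1 + p.2)) ∧
      ∑' p : Freq × Freq, f p.1 * g p.2 * h (p.1 + p.2) ≤
        (∑' k, f k) * √(∑' k, g k ^ 2) * √(∑' k, h k ^ 2) := by
  have h1 : ∀ m : Freq, (Summable fun n => g n * h (m + n)) ∧
      ∑' n, g n * h (m + n) ≤ √(∑' k, g k ^ 2) * √(∑' k, h k ^ 2) := by
    intro m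
    have h2 := tsum_mul_le_sqrt_mul_sqrt (g := fun n => h (m + n)) hg0 (fun n => hh0 _) hg
      ((Equiv.addLeft m).summable_iff.2 hh)
    have h3 : ∑' n, h (m + n) ^ 2 = ∑' k, h k ^ 2 := (Equiv.addLeft m).tsum_eq fun k => h k ^ 2
    rwa [h3] at h2
  have hb : ∀ m, ∑' n, f m * g n * h (m + n) ≤
      f m * (√(∑' k, g k ^ 2) * √(∑' k, h k ^ 2)) := by
    intro m
    simp only [mul_assoc]
    rw [tsum_mul_left]
    exact mul_le_mul_of_nonneg_left (h1 m).2 (hf0 m)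
  have hsb := hf.mul_right (√(∑' k, g k ^ 2) * √(∑' k, h k ^ 2))
  have hs1 : Summable fun m => ∑' n, f m * g n * h (m + n) :=
    Summable.of_nonneg_of_le (fun m => tsum_nonneg fun n =>
      mul_nonneg (mul_nonneg (hf0 _) (hg0 _)) (hh0 _)) hb hsb
  have hs : Summable fun p : Freq × Freq => f p.1 * g p.2 * h (p.1 + p.2) := by
    refine (summable_prod_of_nonneg fun p => mul_nonneg (mul_nonneg (hf0 _) (hg0 _)) (hh0 _)).2
      ⟨fun m => ?_, hs1⟩
    simpa only [mul_assoc] using (h1 m).1.mul_left (f m)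
  refine ⟨hs, ?_⟩
  rw [hs.tsum_prod, mul_assoc, ← tsum_mul_right]
  exact hs1.tsum_le_tsum hb hsb

lemma young_right {f g h : Freq → ℝ} (hf0 : ∀ k, 0 ≤ f k) (hg0 : ∀ k, 0 ≤ g k)
    (hh0 : ∀ k, 0 ≤ h k) (hf : Summable fun k => f k ^ 2) (hg : Summable g)
    (hh : Summable fun k => h k ^ 2) :
    (Summable fun p : Freq × Freq => f p.1 * g p.2 * h (p.1 + p.2)) ∧
      ∑' p : Freq × Freq, f p.1 * g p.2 * h (p.1 + p.2) ≤
        (∑' k, g k) * √(∑' k, f k ^ 2) * √(∑' k, h k ^ 2) := by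
  have h1 := young_left hg0 hf0 hh0 hg hf hh
  have h2 : (fun p : Freq × Freq => f p.1 * g p.2 * h (p.1 + p.2)) =
      (fun p : Freq × Freq => g p.1 * f p.2 * h (p.1 + p.2)) ∘ Equiv.prodComm Freq Freq := by
    funext p
    simp only [Function.comp_apply, Equiv.prodComm_apply, Prod.fst_swap, Prod.snd_swap,
      add_comm p.2 p.1]
    ring
  rw [h2]
  refine ⟨(Equiv.summable_iff _).2 h1.1, ?_⟩
  exact ((Equiv.prodComm Freq Freq).tsum_eq _).trans_le h1.2

lemma norm_tri_le {f g h : Freq → ℂ} {F : Freq × Freq → ℝ} {c : ℝ}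
    (hF : ∀ p : Freq × Freq, |adKer p.1 p.2| * ‖f p.1‖ * ‖g p.2‖ * ‖h (p.1 + p.2)‖ ≤ F p)
    (hs : Summable F) (hc : ∑' p, F p ≤ c) : ‖tri f g h‖ ≤ c := by
  refine (tsum_of_norm_bounded hs.hasSum fun p => ?_).trans hc
  rw [norm_tri_term]
  exact hF p

/-! ### Homogeneous Sobolev norms of sequences -/

/-- The homogeneous Sobolev norm of a sequence of Fourier coefficients. -/
def hs (s : ℝ) (f : Freq → ℂ) : ℝ := √(∑' k : Freq, len k ^ (2 * s) * ‖f k‖ ^ 2)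

/-- Finiteness of `hs s f`. -/
def FiniteHs (s : ℝ) (f : Freq → ℂ) : Prop := Summable fun k : Freq => len k ^ (2 * s) * ‖f k‖ ^ 2

lemma hs_nonneg (s : ℝ) (f : Freq → ℂ) : 0 ≤ hs s f := Real.sqrt_nonneg _

lemma hs_sq (s : ℝ) (f : Freq → ℂ) : hs s f ^ 2 = ∑' k : Freq, len k ^ (2 * s) * ‖f k‖ ^ 2 :=
  Real.sq_sqrt (tsum_nonneg fun k => mul_nonneg (Real.rpow_nonneg (len_nonneg k) _) (sq_nonneg _))

lemma len_rpow_mul_sq (s : ℝ) (f : Freq → ℂ) (k : Freq) :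
    (len k ^ s * ‖f k‖) ^ 2 = len k ^ (2 * s) * ‖f k‖ ^ 2 := by
  rw [mul_pow, ← Real.rpow_mul_natCast (len_nonneg k), mul_comm s]
  norm_num

lemma hs_eq (s : ℝ) (f : Freq → ℂ) : hs s f = √(∑' k : Freq, (len k ^ s * ‖f k‖) ^ 2) := by
  simp only [hs, len_rpow_mul_sq]

lemma hs_zero_eq (f : Freq → ℂ) : hs 0 f = √(∑' k : Freq, ‖f k‖ ^ 2) := by simp [hs]

lemma FiniteHs.summable_sq {s : ℝ} {f : Freq → ℂ} (h : FiniteHs s f) :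
    Summable fun k : Freq => (len k ^ s * ‖f k‖) ^ 2 := by
  simpa only [len_rpow_mul_sq, FiniteHs] using h

lemma len_rpow_nonneg (k : Freq) (s : ℝ) : 0 ≤ len k ^ s := Real.rpow_nonneg (len_nonneg k) s

lemma len_rpow_le_rpow {r s : ℝ} (hr : 0 < r) (hrs : r ≤ s) (k : Freq) : len k ^ r ≤ len k ^ s := by
  by_cases hk : k = 0
  · subst hk
    rw [len_zero, Real.zero_rpow hr.ne', Real.zero_rpow (hr.trans_le hrs).ne']
  · exact Real.rpow_le_rpow_of_exponent_le (one_le_len hk) hrs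

lemma FiniteHs.mono {r s : ℝ} {f : Freq → ℂ} (hr : 0 < r) (hrs : r ≤ s) (h : FiniteHs s f) :
    FiniteHs r f :=
  Summable.of_nonneg_of_le (fun k => mul_nonneg (len_rpow_nonneg k _) (sq_nonneg _))
    (fun k => mul_le_mul_of_nonneg_right (len_rpow_le_rpow (by linarith) (by linarith) k)
      (sq_nonneg _)) h

lemma hs_mono {r s : ℝ} {f : Freq → ℂ} (hr : 0 < r) (hrs : r ≤ s) (h : FiniteHs s f) :
    hs r f ≤ hs s f :=
  Real.sqrt_le_sqrt ((h.mono hr hrs).tsum_le_tsum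
    (fun k => mul_le_mul_of_nonneg_right (len_rpow_le_rpow (by linarith) (by linarith) k)
      (sq_nonneg _)) h)

lemma FiniteHs.len_rpow_mul_le {s : ℝ} {f : Freq → ℂ} (h : FiniteHs s f) (k : Freq) :
    len k ^ s * ‖f k‖ ≤ hs s f := by
  rw [hs_eq]
  exact Real.le_sqrt_of_sq_le (h.summable_sq.le_tsum k fun _ _ => sq_nonneg _)

/-- The square root of the lattice sum `∑ |k|^(-2r)`. -/
def latticeConst (r : ℝ) : ℝ := √(∑' k : Freq, len k ^ (-(2 * r)))

lemma latticeConst_nonneg (r : ℝ) : 0 ≤ latticeConst r := Real.sqrt_nonneg _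

lemma latticeConst_anti {r r' : ℝ} (hr : 1 < r) (hrr : r ≤ r') :
    latticeConst r' ≤ latticeConst r := by
  refine Real.sqrt_le_sqrt ((summable_len_rpow (by linarith)).tsum_le_tsum (fun k => ?_)
    (summable_len_rpow (by linarith)))
  by_cases hk : k = 0
  · subst hk
    rw [len_zero, Real.zero_rpow (by linarith), Real.zero_rpow (by linarith)]
  · exact Real.rpow_le_rpow_of_exponent_le (one_le_len hk) (by linarith)

/-- Cauchy–Schwarz against `|k|^(-r)`, square summable in two dimensions exactly when `r > 1`. The
zero frequency drops out because `0 ^ (-r) = 0` in Lean. -/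
lemma FiniteHs.lone {q r : ℝ} {f : Freq → ℂ} (h : FiniteHs q f) (hr : 1 < r) :
    (Summable fun k => len k ^ (-r) * (len k ^ q * ‖f k‖)) ∧
      ∑' k, len k ^ (-r) * (len k ^ q * ‖f k‖) ≤ latticeConst r * hs q f := by
  have h1 : ∀ k : Freq, (len k ^ (-r)) ^ 2 = len k ^ (-(2 * r)) := fun k => by
    rw [← Real.rpow_mul_natCast (len_nonneg k)]
    congr 1
    push_cast
    ring
  have h2 := tsum_mul_le_sqrt_mul_sqrt (fun k => len_rpow_nonneg k (-r))
    (fun k => mul_nonneg (len_rpow_nonneg k q) (norm_nonneg (f k)))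
    (by simpa only [h1] using summable_len_rpow (r := 2 * r) (by linarith)) h.summable_sq
  simpa only [h1, ← hs_eq, latticeConst] using h2

lemma FiniteHs.len_lone {f : Freq → ℂ} (h : FiniteHs 3 f) :
    (Summable fun k => len k * ‖f k‖) ∧ ∑' k, len k * ‖f k‖ ≤ latticeConst 2 * hs 3 f := by
  have h1 : ∀ k : Freq, len k ^ (-(2 : ℝ)) * (len k ^ (3 : ℝ) * ‖f k‖) = len k * ‖f k‖ := by
    intro k
    by_cases hk : k = 0
    · subst hk
      rw [len_zero, Real.zero_rpow (by norm_num), zero_mul, zero_mul]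
    · rw [← mul_assoc, ← Real.rpow_add (len_pos hk)]
      norm_num
  simpa only [h1] using h.lone (r := 2) (by norm_num)

/-! ### Estimates of the trilinear form -/

/-- The derivative falls on `g`, and the ℓ¹ norm of `|k| g` plays the role of a Lipschitz bound;
both copies of `f` stay in ℓ². -/
lemma norm_tri_le_of_lipschitz {f g : Freq → ℂ} (hf : Summable fun k => ‖f k‖ ^ 2)
    (hg : FiniteHs 3 g) : ‖tri f g f‖ ≤ latticeConst 2 * hs 3 g * hs 0 f ^ 2 := by
  have h := young_right (f := fun k => ‖f k‖) (g := fun k => len k * ‖g k‖)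
    (h := fun k => ‖f k‖) (fun _ => norm_nonneg _)
    (fun k => mul_nonneg (len_nonneg k) (norm_nonneg _)) (fun _ => norm_nonneg _) hf
    hg.len_lone.1 hf
  refine norm_tri_le (fun p => ?_) h.1 (h.2.trans ?_)
  · calc |adKer p.1 p.2| * ‖f p.1‖ * ‖g p.2‖ * ‖f (p.1 + p.2)‖
        ≤ len p.2 * ‖f p.1‖ * ‖g p.2‖ * ‖f (p.1 + p.2)‖ := by gcongr; exact abs_adKer_le _ _
      _ = _ := by ring
  · rw [← hs_zero_eq, mul_assoc, ← sq]
    exact mul_le_mul_of_nonneg_right hg.len_lone.2 (sq_nonneg _)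

lemma abs_adKer_mul_len_rpow_le {a : ℝ} (ha0 : 0 ≤ a) (ha2 : a ≤ 2) (m n : Freq) :
    |adKer m n| * len (m + n) ^ a ≤ 4 * (len m ^ (a + 1) + len n ^ (a + 1)) := by
  set M := max (len m) (len n) with hM
  have hM0 : 0 ≤ M := (len_nonneg m).trans (le_max_left _ _)
  -- Here `|m + n|` is at most twice the larger length, and `2 ^ a ≤ 4` since `a ≤ 2`.
  have h1 : len (m + n) ^ a ≤ 4 * M ^ a := by
    calc len (m + n) ^ a ≤ (2 * M) ^ a := by
          refine Real.rpow_le_rpow (len_nonneg _) ?_ ha0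
          linarith [len_add_le m n, le_max_left (len m) (len n), le_max_right (len m) (len n)]
      _ = 2 ^ a * M ^ a := Real.mul_rpow (by norm_num) hM0
      _ ≤ 2 ^ (2 : ℝ) * M ^ a := by
          gcongr
          norm_num
      _ = 4 * M ^ a := by norm_num
  have h2 : M ^ (a + 1) ≤ len m ^ (a + 1) + len n ^ (a + 1) := by
    rcases max_choice (len m) (len n) with h | h <;> rw [hM, h]
    · linarith [len_rpow_nonneg n (a + 1)]
    · linarith [len_rpow_nonneg m (a + 1)]
  calc |adKer m n| * len (m + n) ^ a ≤ M * (4 * M ^ a) :=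
        mul_le_mul ((abs_adKer_le m n).trans (le_max_right _ _)) h1 (len_rpow_nonneg _ _) hM0
    _ = 4 * M ^ (a + 1) := by
        rw [Real.rpow_add_one' hM0 (by linarith)]
        ring
    _ ≤ _ := by linarith

/-- The total of `a + 1` derivatives is moved to the factor of higher frequency, which is measured
in ℓ²; the other factor is measured in ℓ¹, again by the `a + 1` norm. Hence no derivative falls on
`w`. -/
lemma tri_viscous {a : ℝ} {f w : Freq → ℂ} (ha0 : 0 < a) (ha2 : a ≤ 2)
    (hf : FiniteHs (a + 1) f) (hw : Summable fun k => ‖w k‖ ^ 2) :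
    (Summable fun p : Freq × Freq => (adKer p.1 p.2 : ℂ) * f p.1 * f p.2 *
      (starRingEnd ℂ) (((len (p.1 + p.2) ^ a : ℝ) : ℂ) * w (p.1 + p.2))) ∧
    ‖tri f f fun k => ((len k ^ a : ℝ) : ℂ) * w k‖ ≤
      8 * latticeConst (a + 1) * hs (a + 1) f ^ 2 * hs 0 w := by
  set B : Freq → ℝ := fun k => len k ^ (a + 1) * ‖f k‖ with hB
  -- This is `‖f k‖` with the zero mode removed. The homogeneous norm does not control that mode,
  -- but the kernel vanishes whenever one of its arguments is zero.
  set b : Freq → ℝ := fun k => len k ^ (-(a + 1)) * B k with hb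
  have hB0 : ∀ k, 0 ≤ B k := fun k => mul_nonneg (len_rpow_nonneg k _) (norm_nonneg _)
  have hb0 : ∀ k, 0 ≤ b k := fun k => mul_nonneg (len_rpow_nonneg k _) (hB0 k)
  have hbf : ∀ k, k ≠ 0 → b k = ‖f k‖ := fun k hk => by
    rw [hb, hB]
    simp only
    rw [← mul_assoc, ← Real.rpow_add (len_pos hk), neg_add_cancel, Real.rpow_zero, one_mul]
  have hl := hf.lone (r := a + 1) (by linarith)
  have y1 := young_right hB0 hb0 (fun k => norm_nonneg (w k)) hf.summable_sq hl.1 hw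
  have y2 := young_left hb0 hB0 (fun k => norm_nonneg (w k)) hl.1 hf.summable_sq hw
  have hF : ∀ p : Freq × Freq, |adKer p.1 p.2| * ‖f p.1‖ * ‖f p.2‖ *
      ‖((len (p.1 + p.2) ^ a : ℝ) : ℂ) * w (p.1 + p.2)‖ ≤
      4 * (B p.1 * b p.2 * ‖w (p.1 + p.2)‖ + b p.1 * B p.2 * ‖w (p.1 + p.2)‖) := by
    rintro ⟨m, n⟩
    simp only
    have hr : 0 ≤ 4 * (B m * b n * ‖w (m + n)‖ + b m * B n * ‖w (m + n)‖) := by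
      have := hB0 m; have := hB0 n; have := hb0 m; have := hb0 n
      positivity
    by_cases hm : m = 0
    · subst hm
      simpa using hr
    by_cases hn : n = 0
    · subst hn
      simpa using hr
    rw [hbf m hm, hbf n hn, norm_mul, Complex.norm_real,
      Real.norm_of_nonneg (len_rpow_nonneg _ _)]
    calc |adKer m n| * ‖f m‖ * ‖f n‖ * (len (m + n) ^ a * ‖w (m + n)‖)
        = (|adKer m n| * len (m + n) ^ a) * (‖f m‖ * ‖f n‖ * ‖w (m + n)‖) := by ring
      _ ≤ (4 * (len m ^ (a + 1) + len n ^ (a + 1))) * (‖f m‖ * ‖f n‖ * ‖w (m + n)‖) := by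
          have := abs_adKer_mul_len_rpow_le ha0.le ha2 m n
          gcongr
      _ = _ := by simp only [hB]; ring
  have hsum := (y1.1.add y2.1).mul_left 4
  refine ⟨Summable.of_norm_bounded hsum fun p => ?_, norm_tri_le hF hsum ?_⟩
  · rw [norm_tri_term f f fun k => ((len k ^ a : ℝ) : ℂ) * w k]
    exact hF p
  · rw [tsum_mul_left, y1.1.tsum_add y2.1]
    simp only [hB, ← hs_eq, ← hs_zero_eq] at y1 y2
    have h3 : (∑' k, b k) * hs (a + 1) f * hs 0 w ≤
        latticeConst (a + 1) * hs (a + 1) f * hs (a + 1) f * hs 0 w :=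
      mul_le_mul_of_nonneg_right (mul_le_mul_of_nonneg_right hl.2 (hs_nonneg _ _))
        (hs_nonneg _ _)
    calc _ ≤ 4 * ((∑' k, b k) * hs (a + 1) f * hs 0 w + (∑' k, b k) * hs (a + 1) f * hs 0 w) := by
          gcongr
          · exact y1.2
          · exact y2.2
      _ ≤ _ := by
          rw [sq]
          linarith

/-! ### The truncated Sobolev weight -/

/-- A mean value bound, obtained from Bernoulli's inequality for `(x / y) ^ s`. -/
lemma rpow_sub_rpow_le {s x y : ℝ} (hs : 1 ≤ s) (hx : 0 ≤ x) (hxy : x ≤ y) :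
    y ^ s - x ^ s ≤ s * (y - x) * y ^ (s - 1) := by
  rcases hx.trans hxy |>.eq_or_lt with h | h
  · have : x = 0 := le_antisymm (h ▸ hxy) hx
    subst this
    simp [← h]
  · have h1 := one_add_mul_self_le_rpow_one_add (s := x / y - 1) (by
      have := div_nonneg hx h.le
      linarith) hs
    rw [add_sub_cancel, Real.div_rpow hx h.le, le_div_iff₀ (Real.rpow_pos_of_pos h s)] at h1
    have h2 : y ^ s = y * y ^ (s - 1) := by
      rw [Real.rpow_sub_one h.ne']
      field_simp
    have h3 : (1 + s * (x / y - 1)) * y ^ s = y ^ s - s * (y - x) * y ^ (s - 1) := by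
      rw [h2]
      field_simp
      ring
    linarith

/-- The weight `|k|^s`, truncated at `|k| = R`. -/
def cutWeight (s R : ℝ) (k : Freq) : ℝ := min (len k) R ^ s

lemma cutWeight_nonneg {s R : ℝ} (hR : 0 ≤ R) (k : Freq) : 0 ≤ cutWeight s R k :=
  Real.rpow_nonneg (le_min (len_nonneg k) hR) s

lemma cutWeight_le {s R : ℝ} (hs : 0 ≤ s) (hR : 0 ≤ R) (k : Freq) : cutWeight s R k ≤ len k ^ s :=
  Real.rpow_le_rpow (le_min (len_nonneg k) hR) (min_le_left _ _) hs

lemma abs_cutWeight_le {s R : ℝ} (hs : 0 ≤ s) (hR : 0 ≤ R) (k : Freq) :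
    |cutWeight s R k| ≤ R ^ s := by
  rw [abs_of_nonneg (cutWeight_nonneg hR k)]
  exact Real.rpow_le_rpow (le_min (len_nonneg k) hR) (min_le_right _ _) hs

lemma abs_cutWeight_sub_le {s R : ℝ} (hs : 1 ≤ s) (hR : 0 ≤ R) (m n : Freq) :
    |cutWeight s R (m + n) - cutWeight s R n| ≤
      s * len m * (2 * max (len m) (len n)) ^ (s - 1) := by
  -- Either of `m + n` and `n` may have the larger truncated length, so the bound is stated for an
  -- ordered pair and used both ways. Truncation does not increase differences of lengths.
  have key : ∀ k l : Freq, len k ≤ 2 * max (len m) (len n) →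
      |len k - len l| ≤ len m → min (len l) R ≤ min (len k) R →
      |cutWeight s R k - cutWeight s R l| ≤ s * len m * (2 * max (len m) (len n)) ^ (s - 1) := by
    intro k l hk hkl hle
    have hl0 : 0 ≤ min (len l) R := le_min (len_nonneg l) hR
    rw [cutWeight, cutWeight,
      abs_of_nonneg (sub_nonneg.2 (Real.rpow_le_rpow hl0 hle (by linarith)))]
    refine (rpow_sub_rpow_le hs hl0 hle).trans ?_
    have h1 : min (len k) R - min (len l) R ≤ len m :=
      (le_abs_self _).trans ((abs_min_sub_min_le_max _ _ _ _).trans (by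
        simpa using hkl))
    have h2 : min (len k) R ^ (s - 1) ≤ (2 * max (len m) (len n)) ^ (s - 1) :=
      Real.rpow_le_rpow (hl0.trans hle) ((min_le_left _ _).trans hk) (by linarith)
    have h3 := sub_nonneg.2 hle
    have h4 : 0 ≤ min (len k) R ^ (s - 1) := Real.rpow_nonneg (hl0.trans hle) _
    have h5 := len_nonneg m
    gcongr
  have hmax1 := le_max_left (len m) (len n)
  have hmax2 := le_max_right (len m) (len n)
  rcases le_total (min (len n) R) (min (len (m + n)) R) with h | h
  · exact key _ _ (by linarith [len_add_le m n]) (abs_len_sub_len_le m n) h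
  · rw [abs_sub_comm]
    refine key _ _ (by linarith [len_nonneg n]) ?_ h
    rw [abs_sub_comm]
    exact abs_len_sub_len_le m n

lemma abs_cutWeight_sub_mul_le {s R : ℝ} (hs : 1 ≤ s) (hR : 0 ≤ R) (m n : Freq) :
    |cutWeight s R (m + n) - cutWeight s R n| * len n ≤
      s * 2 ^ (s - 1) * (len m ^ s * len n + len m * len n ^ s) := by
  have h1 := mul_le_mul_of_nonneg_right (abs_cutWeight_sub_le hs hR m n) (len_nonneg n)
  refine h1.trans ?_
  rw [Real.mul_rpow (by norm_num) ((len_nonneg m).trans (le_max_left _ _))]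
  have hp : ∀ k : Freq, len k * len k ^ (s - 1) = len k ^ s := fun k => by
    rw [mul_comm, ← Real.rpow_add_one' (len_nonneg k) (by linarith), sub_add_cancel]
  have h2 : len m * max (len m) (len n) ^ (s - 1) * len n ≤ len m ^ s * len n + len m * len n ^ s := by
    have hm := len_nonneg m
    have hn := len_nonneg n
    have hms := len_rpow_nonneg m s
    have hns := len_rpow_nonneg n s
    rcases max_choice (len m) (len n) with h | h <;> rw [h]
    · rw [hp]
      nlinarith [mul_nonneg hm hns]
    · rw [mul_assoc, mul_comm _ (len n), hp]
      nlinarith [mul_nonneg hms hn]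
  calc s * len m * (2 ^ (s - 1) * max (len m) (len n) ^ (s - 1)) * len n
      = s * 2 ^ (s - 1) * (len m * max (len m) (len n) ^ (s - 1) * len n) := by ring
    _ ≤ _ := by gcongr

/-- Subtracting the vanishing form `tri f g g`, with `g` the weighted sequence, replaces the weight
by its increment from `n` to `m + n`. The increment gains a factor `|m|`, so after the kernel's
`|n|` one factor carries `s` derivatives and the other carries one. Nothing in the bound depends on
`R`. -/
lemma norm_tri_cutWeight_le {s R M : ℝ} {f : Freq → ℂ} (hs3 : 3 ≤ s) (hR : 0 ≤ R)
    (hM : Decay M f) (hreal : ∀ k, f (-k) = (starRingEnd ℂ) (f k)) (hf : FiniteHs s f) :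
    ‖tri f f fun k => ((cutWeight s R k ^ 2 : ℝ) : ℂ) * f k‖ ≤
      2 * (s * 2 ^ (s - 1)) * latticeConst 2 * hs s f ^ 3 := by
  set φ := cutWeight s R with hφ
  set g : Freq → ℂ := fun k => (φ k : ℂ) * f k with hg
  have hφb : ∀ k, |φ k| ≤ R ^ s := abs_cutWeight_le (by linarith) hR
  have hgd : Decay (R ^ s * M) g := hM.real_mul hφb
  have hggd : Decay (R ^ s * (R ^ s * M)) fun k => (φ k : ℂ) * g k := hgd.real_mul hφb
  have hgr : ∀ k, g (-k) = (starRingEnd ℂ) (g k) := fun k => by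
    simp [hg, hφ, cutWeight, hreal]
  have hgg : (fun k => ((φ k ^ 2 : ℝ) : ℂ) * f k) = fun k => (φ k : ℂ) * g k := by
    funext k
    simp only [hg]
    push_cast
    ring
  have h1 := tri_self (f := f) hgr
  have h2 : tri f f (fun k => (φ k : ℂ) * g k) = ∑' p : Freq × Freq,
      ((adKer p.1 p.2 : ℂ) * f p.1 * f p.2 * (starRingEnd ℂ) ((φ (p.1 + p.2) : ℂ) * g (p.1 + p.2)) -
        (adKer p.1 p.2 : ℂ) * f p.1 * g p.2 * (starRingEnd ℂ) (g (p.1 + p.2))) := by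
    rw [(summable_tri hM hM hggd).tsum_sub (summable_tri hM hgd hgd)]
    have h3 := h1
    rw [tri] at h3
    rw [h3, sub_zero, tri]
  have hf3 : FiniteHs 3 f := hf.mono (by norm_num) hs3
  have hl := hf3.len_lone
  have hA0 : ∀ k, 0 ≤ len k ^ s * ‖f k‖ := fun k =>
    mul_nonneg (len_rpow_nonneg k s) (norm_nonneg _)
  have hl0 : ∀ k, 0 ≤ len k * ‖f k‖ := fun k => mul_nonneg (len_nonneg k) (norm_nonneg _)
  have y1 := young_right hA0 hl0 hA0 hf.summable_sq hl.1 hf.summable_sq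
  have y2 := young_left hl0 hA0 hA0 hl.1 hf.summable_sq hf.summable_sq
  rw [hgg, h2]
  have hsum := (y1.1.add y2.1).mul_left (s * 2 ^ (s - 1))
  refine (tsum_of_norm_bounded hsum.hasSum fun p => ?_).trans ?_
  · obtain ⟨m, n⟩ := p
    simp only
    have e1 : (adKer m n : ℂ) * f m * f n * (starRingEnd ℂ) ((φ (m + n) : ℂ) * g (m + n)) -
        (adKer m n : ℂ) * f m * g n * (starRingEnd ℂ) (g (m + n)) =
        ((adKer m n * ((φ (m + n) - φ n) * φ (m + n)) : ℝ) : ℂ) *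
          (f m * f n * (starRingEnd ℂ) (f (m + n))) := by
      simp only [hg, map_mul, Complex.conj_ofReal]
      push_cast
      ring
    rw [e1, norm_mul, Complex.norm_real, Real.norm_eq_abs, abs_mul, abs_mul, norm_mul, norm_mul,
      RCLike.norm_conj, abs_of_nonneg (cutWeight_nonneg hR (m + n))]
    calc |adKer m n| * (|φ (m + n) - φ n| * φ (m + n)) * (‖f m‖ * ‖f n‖ * ‖f (m + n)‖)
        ≤ len n * (|φ (m + n) - φ n| * len (m + n) ^ s) * (‖f m‖ * ‖f n‖ * ‖f (m + n)‖) := by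
          gcongr
          · exact mul_nonneg (abs_nonneg _) (cutWeight_nonneg hR _)
          · exact len_nonneg n
          · exact abs_adKer_le m n
          · exact cutWeight_le (by linarith) hR _
      _ = (|φ (m + n) - φ n| * len n) * (len (m + n) ^ s * (‖f m‖ * ‖f n‖ * ‖f (m + n)‖)) := by
          ring
      _ ≤ (s * 2 ^ (s - 1) * (len m ^ s * len n + len m * len n ^ s)) *
            (len (m + n) ^ s * (‖f m‖ * ‖f n‖ * ‖f (m + n)‖)) := by
          have h3 := len_rpow_nonneg (m + n) s
          have h4 : (1 : ℝ) ≤ s := by linarith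
          have h5 := abs_cutWeight_sub_mul_le h4 hR m n
          gcongr
      _ = _ := by ring
  · rw [tsum_mul_left, y1.1.tsum_add y2.1]
    simp only [← hs_eq] at y1 y2
    have h3 : (∑' k, len k * ‖f k‖) * hs s f * hs s f ≤
        latticeConst 2 * hs s f * hs s f * hs s f := by
      have := hs_nonneg s f
      have h4 := hs_mono (by norm_num) hs3 hf
      have h5 := latticeConst_nonneg 2
      gcongr
      exact hl.2.trans (by gcongr)
    have h6 : 0 ≤ s * (2 : ℝ) ^ (s - 1) := by positivity
    calc _ ≤ s * 2 ^ (s - 1) * ((∑' k, len k * ‖f k‖) * hs s f * hs s f +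
          (∑' k, len k * ‖f k‖) * hs s f * hs s f) := by
          gcongr
          · exact y1.2
          · exact y2.2
      _ ≤ s * 2 ^ (s - 1) * (2 * (latticeConst 2 * hs s f * hs s f * hs s f)) := by
          gcongr
          linarith
      _ = _ := by ring

/-! ### Grönwall's inequality with bounded measurable coefficients -/

lemma abs_exp_neg_sub_exp_neg_le {a b : ℝ} (ha : 0 ≤ a) (hb : 0 ≤ b) :
    |Real.exp (-a) - Real.exp (-b)| ≤ |a - b| := by
  wlog hab : a ≤ b generalizing a b
  · rw [abs_sub_comm, abs_sub_comm a]
    exact this hb ha (le_of_not_ge hab)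
  rw [abs_of_nonneg (sub_nonneg.2 (Real.exp_le_exp.2 (by linarith))), abs_sub_comm,
    abs_of_nonneg (sub_nonneg.2 hab)]
  have h1 : Real.exp (-b) = Real.exp (-a) * Real.exp (a - b) := by
    rw [← Real.exp_add]; ring_nf
  have h2 := Real.add_one_le_exp (a - b)
  have h3 : Real.exp (-a) ≤ 1 := Real.exp_le_one_iff.2 (by linarith)
  have h4 := Real.exp_pos (-a)
  rw [h1]
  nlinarith

/-- The coefficient `h` is only bounded and measurable, so `E exp(-H)` is differentiable merely
almost everywhere. It is absolutely continuous, and that suffices to integrate its derivative. -/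
lemma gronwall_integral {t B E₀ : ℝ} {G h q : ℝ → ℝ} (ht : 0 ≤ t)
    (hG : IntervalIntegrable G volume 0 t) (hh : IntervalIntegrable h volume 0 t)
    (hq : IntervalIntegrable q volume 0 t) (hh0 : ∀ x ∈ Icc 0 t, 0 ≤ h x)
    (hhB : ∀ x ∈ Icc 0 t, h x ≤ B)
    (hle : ∀ x ∈ Icc 0 t, G x ≤ h x * (E₀ + ∫ y in (0 : ℝ)..x, G y) + q x) :
    E₀ + ∫ x in (0 : ℝ)..t, G x ≤
      E₀ * Real.exp (∫ x in (0 : ℝ)..t, h x) +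
        ∫ ζ in (0 : ℝ)..t, Real.exp (∫ x in ζ..t, h x) * q ζ := by
  have hu : uIcc 0 t = Icc 0 t := uIcc_of_le ht
  have hB0 : 0 ≤ B := (hh0 0 ⟨le_rfl, ht⟩).trans (hhB 0 ⟨le_rfl, ht⟩)
  have hsub : ∀ x ∈ Icc 0 t, ∀ y ∈ Icc 0 t, IntervalIntegrable h volume x y := by
    intro x hx y hy
    exact hh.mono_set (by rw [hu]; exact uIcc_subset_Icc hx hy)
  set H : ℝ → ℝ := fun x => ∫ y in (0 : ℝ)..x, h y with hH
  set E : ℝ → ℝ := fun x => E₀ + ∫ y in (0 : ℝ)..x, G y with hE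
  have hH0 : ∀ x ∈ Icc 0 t, 0 ≤ H x := fun x hx =>
    intervalIntegral.integral_nonneg hx.1 fun u hu => hh0 u ⟨hu.1, hu.2.trans hx.2⟩
  have h0 : (0 : ℝ) ∈ Icc 0 t := ⟨le_rfl, ht⟩
  have htt : t ∈ Icc 0 t := ⟨ht, le_rfl⟩
  have hexp : AbsolutelyContinuousOnInterval (fun x => Real.exp (-H x)) 0 t := by
    refine LipschitzOnWith.absolutelyContinuousOnInterval (K := B.toNNReal)
      (LipschitzOnWith.of_dist_le_mul fun x hx y hy => ?_)
    rw [hu] at hx hy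
    rw [Real.coe_toNNReal B hB0, Real.dist_eq, Real.dist_eq]
    refine (abs_exp_neg_sub_exp_neg_le (hH0 x hx) (hH0 y hy)).trans ?_
    simp only [hH]
    rw [intervalIntegral.integral_interval_sub_left (hsub 0 h0 x hx) (hsub 0 h0 y hy),
      ← Real.norm_eq_abs]
    refine intervalIntegral.norm_integral_le_of_norm_le_const fun z hz => ?_
    have hz' : z ∈ Icc 0 t := uIcc_subset_Icc hy hx (uIoc_subset_uIcc hz)
    rw [Real.norm_of_nonneg (hh0 z hz')]
    exact hhB z hz'
  have hEac : AbsolutelyContinuousOnInterval E 0 t := by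
    have h1 := hG.absolutelyContinuousOnInterval_intervalIntegral (c := 0) (by simp)
    have h2 : AbsolutelyContinuousOnInterval (fun _ : ℝ => E₀) 0 t :=
      contDiffOn_const.absolutelyContinuousOnInterval
    exact h2.add h1
  have hprod := hEac.fun_mul hexp
  have hderiv : ∀ᵐ x, x ∈ uIcc 0 t →
      deriv (fun x => E x * Real.exp (-H x)) x = (G x - h x * E x) * Real.exp (-H x) := by
    filter_upwards [hG.ae_hasDerivAt_integral, hh.ae_hasDerivAt_integral] with x hx1 hx2 hx
    have d1 : HasDerivAt E (G x) x := (hx1 hx 0 (by simp)).const_add E₀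
    have d2 : HasDerivAt H (h x) x := hx2 hx 0 (by simp)
    refine HasDerivAt.deriv ?_
    convert! d1.mul d2.neg.exp using 1
    simp only [Pi.neg_apply]
    ring
  have hHc : ContinuousOn (fun x => Real.exp (-H x)) (uIcc 0 t) := hexp.continuousOn
  have key : E t * Real.exp (-H t) - E₀ ≤ ∫ x in (0 : ℝ)..t, q x * Real.exp (-H x) := by
    have h1 := hprod.integral_deriv_eq_sub
    have h2 : E 0 * Real.exp (-H 0) = E₀ := by simp [hE, hH]
    simp only [h2] at h1
    rw [← h1]
    refine intervalIntegral.integral_mono_ae_restrict ht hprod.intervalIntegrable_deriv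
      (hq.mul_continuousOn hHc) ?_
    rw [Filter.EventuallyLE, ae_restrict_iff' measurableSet_Icc]
    filter_upwards [hderiv] with x hx hx'
    rw [hx (by rwa [hu])]
    refine mul_le_mul_of_nonneg_right ?_ (Real.exp_pos _).le
    linarith [hle x hx']
  have h3 : ∫ ζ in (0 : ℝ)..t, Real.exp (∫ x in ζ..t, h x) * q ζ =
      Real.exp (H t) * ∫ x in (0 : ℝ)..t, q x * Real.exp (-H x) := by
    rw [← intervalIntegral.integral_const_mul]
    refine intervalIntegral.integral_congr fun ζ hζ => ?_
    rw [hu] at hζ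
    change Real.exp (∫ x in ζ..t, h x) * q ζ = Real.exp (H t) * (q ζ * Real.exp (-H ζ))
    rw [← intervalIntegral.integral_interval_sub_left (hsub 0 h0 t htt) (hsub 0 h0 ζ hζ),
      sub_eq_add_neg, Real.exp_add]
    ring
  have h4 := mul_le_mul_of_nonneg_left key (Real.exp_pos (H t)).le
  have h5 : Real.exp (H t) * Real.exp (-H t) = 1 := by
    rw [← Real.exp_add, add_neg_cancel, Real.exp_zero]
  rw [h3]
  have h6 : Real.exp (H t) * (E t * Real.exp (-H t) - E₀) = E t - E₀ * Real.exp (H t) := by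
    linear_combination E t * h5
  linarith

/-- If `z ≤ a + b ∫ z^(3/2)`, written for `y` with `y² = z`, then `y` stays below `2 r` as long as
`8 b r t < 3` and `a ≤ r²`. -/
lemma sq_le_of_integral_cube {T a b r : ℝ} {y : ℝ → ℝ} (hb : 0 ≤ b) (hr : 0 < r)
    (har : a ≤ r ^ 2) (hbr : 8 * b * r * T < 3) (hy0 : ∀ t ∈ Icc 0 T, 0 ≤ y t)
    (hy : IntervalIntegrable (fun t => y t ^ 3) volume 0 T)
    (hle : ∀ t ∈ Icc 0 T, y t ^ 2 ≤ a + b * ∫ τ in (0 : ℝ)..t, y τ ^ 3) :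
    ∀ t ∈ Icc 0 T, y t ≤ 2 * r := by
  intro t ht
  have hT : 0 ≤ T := ht.1.trans ht.2
  set Z : ℝ → ℝ := fun t => a + b * ∫ τ in (0 : ℝ)..t, y τ ^ 3 with hZ
  have hcont : ContinuousOn Z (Icc 0 T) := by
    have h1 := intervalIntegral.continuousOn_primitive_interval' hy (left_mem_uIcc)
    rw [uIcc_of_le hT] at h1
    exact continuousOn_const.add (continuousOn_const.mul h1)
  have hint : ∀ x ∈ Icc 0 T, ∀ x' ∈ Icc 0 T,
      IntervalIntegrable (fun t => y t ^ 3) volume x x' := fun x hx x' hx' =>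
    hy.mono_set (by rw [uIcc_of_le hT]; exact uIcc_subset_Icc hx hx')
  have h0 : (0 : ℝ) ∈ Icc 0 T := ⟨le_rfl, hT⟩
  have hmono : ∀ x ∈ Icc 0 T, ∀ x' ∈ Icc 0 T, x ≤ x' → Z x ≤ Z x' := by
    intro x hx x' hx' hxx
    have h1 := intervalIntegral.integral_add_adjacent_intervals (hint 0 h0 x hx) (hint x hx x' hx')
    have h2 : 0 ≤ ∫ τ in x..x', y τ ^ 3 := intervalIntegral.integral_nonneg hxx fun u hu =>
      pow_nonneg (hy0 u ⟨hx.1.trans hu.1, hu.2.trans hx'.2⟩) 3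
    simp only [hZ]
    rw [← h1]
    nlinarith [mul_nonneg hb h2]
  -- Continuity argument: at a point where `Z = 4r²` the inequality would give `4r² ≤ r² + 8bTr³`,
  -- and `8brT < 3` makes the right side smaller than `4r²`.
  have hlt : Z t ≤ 4 * r ^ 2 := by
    by_contra! hgt
    have hZ0 : Z 0 ≤ 4 * r ^ 2 := by
      simp only [hZ, intervalIntegral.integral_same, mul_zero, add_zero]
      nlinarith [sq_nonneg r]
    have hsub : Icc 0 t ⊆ Icc 0 T := Icc_subset_Icc_right ht.2
    obtain ⟨x, hx, hxZ⟩ := intermediate_value_Icc ht.1 (hcont.mono hsub) ⟨hZ0, hgt.le⟩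
    have hxT := hsub hx
    have hyb : ∀ u ∈ Icc 0 x, y u ^ 3 ≤ (2 * r) ^ 3 := by
      intro u hu
      have huT : u ∈ Icc 0 T := ⟨hu.1, hu.2.trans hxT.2⟩
      refine pow_le_pow_left₀ (hy0 u huT) ?_ 3
      refine abs_le_of_sq_le_sq' ?_ (by positivity) |>.2
      calc y u ^ 2 ≤ Z u := hle u huT
        _ ≤ Z x := hmono u huT x hxT hu.2
        _ = (2 * r) ^ 2 := by rw [hxZ]; ring
    have h1 : ∫ τ in (0 : ℝ)..x, y τ ^ 3 ≤ ∫ τ in (0 : ℝ)..x, (2 * r) ^ 3 :=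
      intervalIntegral.integral_mono_on hx.1 (hint 0 h0 x hxT) intervalIntegrable_const hyb
    rw [intervalIntegral.integral_const, sub_zero, smul_eq_mul] at h1
    have h2 : x * (2 * r) ^ 3 ≤ T * (2 * r) ^ 3 :=
      mul_le_mul_of_nonneg_right hxT.2 (by positivity)
    have h3 := mul_le_mul_of_nonneg_left (h1.trans h2) hb
    have h4 : r ^ 2 * (8 * b * r * T) < r ^ 2 * 3 := mul_lt_mul_of_pos_left hbr (by positivity)
    have h5 : Z x ≤ r ^ 2 + b * (T * (2 * r) ^ 3) := by
      simp only [hZ]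
      linarith
    nlinarith
  refine abs_le_of_sq_le_sq' ?_ (by positivity) |>.2
  calc y t ^ 2 ≤ Z t := hle t ht
    _ ≤ (2 * r) ^ 2 := by linarith

/-! ### The energy identity -/

lemma normSq_sub_eq_integral {T : ℝ} {c d : ℝ → ℂ} (hd : ContinuousOn d (Icc 0 T))
    (hc : ∀ t ∈ Icc 0 T, c t = c 0 + ∫ τ in (0 : ℝ)..t, d τ) {t : ℝ} (ht : t ∈ Icc 0 T) :
    ‖c t‖ ^ 2 - ‖c 0‖ ^ 2 = ∫ τ in (0 : ℝ)..t, 2 * (d τ * (starRingEnd ℂ) (c τ)).re := by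
  have hT : 0 ≤ T := ht.1.trans ht.2
  have hdi : IntervalIntegrable d volume 0 T :=
    ContinuousOn.intervalIntegrable (by rwa [uIcc_of_le hT])
  have hcc : ContinuousOn c (Icc 0 T) := by
    have h1 := intervalIntegral.continuousOn_primitive_interval' hdi left_mem_uIcc
    rw [uIcc_of_le hT] at h1
    exact (continuousOn_const.add h1).congr hc
  have hsub : Icc 0 t ⊆ Icc 0 T := Icc_subset_Icc_right ht.2
  refine (intervalIntegral.integral_eq_sub_of_hasDerivAt_of_le ht.1
    (f := fun τ => ‖c τ‖ ^ 2) ((hcc.mono hsub).norm.pow 2) (fun x hx => ?_) ?_).symm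
  · have hxT : x ∈ Ioo 0 T := ⟨hx.1, hx.2.trans_le ht.2⟩
    have hn : Icc 0 T ∈ nhds x := Icc_mem_nhds hxT.1 hxT.2
    have h1 : HasDerivAt (fun u => c 0 + ∫ τ in (0 : ℝ)..u, d τ) (d x) x := by
      refine HasDerivAt.const_add _ (intervalIntegral.integral_hasDerivAt_right ?_ ?_ ?_)
      · exact hdi.mono_set (by
          rw [uIcc_of_le hT]
          exact uIcc_subset_Icc ⟨le_rfl, hT⟩ ⟨hxT.1.le, hxT.2.le⟩)
      · exact ⟨Icc 0 T, hn, hd.aestronglyMeasurable measurableSet_Icc⟩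
      · exact hd.continuousAt hn
    have h2 : HasDerivAt c (d x) x :=
      h1.congr_of_eventuallyEq (Filter.eventually_of_mem hn hc)
    have h3 := h2.norm_sq
    convert! h3 using 1
  · refine ContinuousOn.intervalIntegrable ?_
    rw [uIcc_of_le ht.1]
    have h1 := hd.mono hsub
    have h2 := hcc.mono hsub
    exact continuousOn_const.mul (Complex.continuous_re.comp_continuousOn
      (h1.mul (Complex.continuous_conj.comp_continuousOn h2)))

/-- Each mode satisfies the identity by the fundamental theorem of calculus; the summable bound
permits summing under the time integral. The weight `p` serves both the gap and the truncated
Sobolev energy. -/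
lemma energy_identity {T : ℝ} {c d : ℝ → Freq → ℂ} {p bound : Freq → ℝ}
    (hd : ∀ k, ContinuousOn (fun t => d t k) (Icc 0 T))
    (hc : ∀ t ∈ Icc 0 T, ∀ k, c t k = c 0 k + ∫ τ in (0 : ℝ)..t, d τ k)
    (hbound : ∀ t ∈ Icc 0 T, ∀ k, ‖(p k : ℂ) * d t k * (starRingEnd ℂ) (c t k)‖ ≤ bound k)
    (hs : Summable bound) (hp : ∀ t ∈ Icc 0 T, Summable fun k => p k * ‖c t k‖ ^ 2) :
    ContinuousOn (fun τ => 2 * (∑' k, (p k : ℂ) * d τ k * (starRingEnd ℂ) (c τ k)).re)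
        (Icc 0 T) ∧
      ∀ t ∈ Icc 0 T, ∑' k, p k * ‖c t k‖ ^ 2 = ∑' k, p k * ‖c 0 k‖ ^ 2 +
        ∫ τ in (0 : ℝ)..t, 2 * (∑' k, (p k : ℂ) * d τ k * (starRingEnd ℂ) (c τ k)).re := by
  have hcc : ∀ k, ContinuousOn (fun t => c t k) (Icc 0 T) := by
    intro k
    rcases lt_or_ge T 0 with hT | hT
    · rw [Icc_eq_empty (by linarith)]
      exact continuousOn_empty _
    have hdi : IntervalIntegrable (fun t => d t k) volume 0 T :=
      ContinuousOn.intervalIntegrable (by rw [uIcc_of_le hT]; exact hd k)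
    have h1 := intervalIntegral.continuousOn_primitive_interval' hdi left_mem_uIcc
    rw [uIcc_of_le hT] at h1
    exact (continuousOn_const.add h1).congr fun t ht => hc t ht k
  have hterm : ∀ k, ContinuousOn (fun τ => (p k : ℂ) * d τ k * (starRingEnd ℂ) (c τ k))
      (Icc 0 T) := fun k =>
    (continuousOn_const.mul (hd k)).mul (Complex.continuous_conj.comp_continuousOn (hcc k))
  have hsummable : ∀ t ∈ Icc 0 T,
      Summable fun k => (p k : ℂ) * d t k * (starRingEnd ℂ) (c t k) := fun t ht =>
    Summable.of_norm_bounded hs (hbound t ht)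
  refine ⟨continuousOn_const.mul (Complex.continuous_re.comp_continuousOn
    (continuousOn_tsum hterm hs fun k t ht => hbound t ht k)), fun t ht => ?_⟩
  have hT : 0 ≤ T := ht.1.trans ht.2
  have h0 : (0 : ℝ) ∈ Icc 0 T := ⟨le_rfl, hT⟩
  have hsub : Icc 0 t ⊆ Icc 0 T := Icc_subset_Icc_right ht.2
  have hIoc : ∀ τ ∈ uIoc 0 t, τ ∈ Icc 0 T := fun τ hτ => by
    rw [uIoc_of_le ht.1] at hτ
    exact hsub (Ioc_subset_Icc_self hτ)
  have hre : ∀ k, ContinuousOn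
      (fun τ => 2 * ((p k : ℂ) * d τ k * (starRingEnd ℂ) (c τ k)).re) (Icc 0 T) := fun k =>
    continuousOn_const.mul (Complex.continuous_re.comp_continuousOn (hterm k))
  have h1 := intervalIntegral.hasSum_integral_of_dominated_convergence (μ := volume)
    (a := 0) (b := t)
    (F := fun k τ => 2 * ((p k : ℂ) * d τ k * (starRingEnd ℂ) (c τ k)).re)
    (f := fun τ => 2 * (∑' k, (p k : ℂ) * d τ k * (starRingEnd ℂ) (c τ k)).re)
    (fun k _ => 2 * bound k)
    (fun k => by
      rw [uIoc_of_le ht.1]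
      exact ((hre k).mono (Ioc_subset_Icc_self.trans hsub)).aestronglyMeasurable measurableSet_Ioc)
    (fun k => Filter.Eventually.of_forall fun τ hτ => by
      rw [norm_mul, Real.norm_of_nonneg (by norm_num : (0 : ℝ) ≤ 2)]
      gcongr
      exact (Complex.abs_re_le_norm _).trans (hbound τ (hIoc τ hτ) k))
    (Filter.Eventually.of_forall fun τ _ => hs.mul_left 2) intervalIntegrable_const
    (Filter.Eventually.of_forall fun τ hτ =>
      (Complex.hasSum_re (hsummable τ (hIoc τ hτ)).hasSum).mul_left 2)
  have h2 : ∀ k, ∫ τ in (0 : ℝ)..t, 2 * ((p k : ℂ) * d τ k * (starRingEnd ℂ) (c τ k)).re =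
      p k * ‖c t k‖ ^ 2 - p k * ‖c 0 k‖ ^ 2 := by
    intro k
    rw [← mul_sub, normSq_sub_eq_integral (c := fun t => c t k) (hd k) (fun t ht => hc t ht k) ht,
      ← intervalIntegral.integral_const_mul]
    refine intervalIntegral.integral_congr fun τ _ => ?_
    rw [mul_assoc, Complex.re_ofReal_mul]
    ring
  simp only [h2] at h1
  rw [← h1.tsum_eq, (hp t ht).tsum_sub (hp 0 h0)]
  ring

/-! ### Time dependence of the nonlinear term and of the norms -/

lemma continuousOn_adv {S : Set ℝ} {M : ℝ} {c : ℝ → Freq → ℂ} (hM : ∀ t ∈ S, Decay M (c t))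
    (hc : ∀ k, ContinuousOn (fun t => c t k) S) (k : Freq) :
    ContinuousOn (fun t => adv (c t) (c t) k) S := by
  refine continuousOn_tsum
    (fun m => (continuousOn_const.mul (hc m)).mul (hc (k - m)))
    ((summable_inv_one_add_len_cube.mul_left M).mul_left M) fun m t ht => ?_
  rw [norm_mul, norm_mul, Complex.norm_real, Real.norm_eq_abs]
  calc |adKer m (k - m)| * ‖c t m‖ * ‖c t (k - m)‖
      ≤ len (k - m) * ‖c t m‖ * ‖c t (k - m)‖ := by gcongr; exact abs_adKer_le _ _
    _ = (len (k - m) * ‖c t (k - m)‖) * ‖c t m‖ := by ring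
    _ ≤ M * (M * ((1 + len m) ^ 3)⁻¹) :=
        mul_le_mul ((hM t ht).len_mul_norm_le _) (hM t ht m) (norm_nonneg _) (hM t ht).nonneg

lemma Decay.len_rpow_mul_norm_le {M s : ℝ} {f : Freq → ℂ} (h : Decay M f) (hs0 : 0 ≤ s)
    (hs : s ≤ 3) (k : Freq) : len k ^ s * ‖f k‖ ≤ M := by
  have h1 := one_add_len_pos k
  have h2 : len k ^ s ≤ (1 + len k) ^ 3 := by
    calc len k ^ s ≤ (1 + len k) ^ s :=
          Real.rpow_le_rpow (len_nonneg k) (by linarith) hs0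
      _ ≤ (1 + len k) ^ (3 : ℝ) :=
          Real.rpow_le_rpow_of_exponent_le (by linarith [len_nonneg k]) hs
      _ = (1 + len k) ^ 3 := by norm_cast
  calc len k ^ s * ‖f k‖ ≤ (1 + len k) ^ 3 * (M * ((1 + len k) ^ 3)⁻¹) :=
        mul_le_mul h2 (h k) (norm_nonneg _) (by positivity)
    _ = M := by field_simp

/-- A crude bound that serves only to dominate series in the energy identities. -/
lemma norm_adv_le {M a : ℝ} {f : Freq → ℂ} (h : Decay M f) (ha0 : 0 ≤ a) (ha2 : a ≤ 2) (k : Freq) :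
    len k ^ a * ‖adv f f k‖ ≤ 8 * M * ∑' m, ‖f m‖ := by
  have h1 : Summable fun m => ‖f (k - m)‖ := (Equiv.subLeft k).summable_iff.2 h.summable
  have h2 : ∑' m, ‖f (k - m)‖ = ∑' m, ‖f m‖ := (Equiv.subLeft k).tsum_eq fun m => ‖f m‖
  have hsum := (h.summable.add h1).mul_left (4 * M)
  have hval : ∑' m, 4 * M * (‖f m‖ + ‖f (k - m)‖) = 8 * M * ∑' m, ‖f m‖ := by
    rw [tsum_mul_left, h.summable.tsum_add h1, h2]
    ring
  rw [← hval, adv, ← Real.norm_of_nonneg (len_rpow_nonneg k a), ← Complex.norm_real, ← norm_mul,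
    ← tsum_mul_left]
  refine tsum_of_norm_bounded hsum.hasSum fun m => ?_
  have h3 := abs_adKer_mul_len_rpow_le ha0 ha2 m (k - m)
  rw [add_sub_cancel] at h3
  rw [norm_mul, norm_mul, norm_mul, Complex.norm_real, Complex.norm_real, Real.norm_eq_abs,
    Real.norm_eq_abs, abs_of_nonneg (len_rpow_nonneg k a)]
  have h4 := h.len_rpow_mul_norm_le (s := a + 1) (by linarith) (by linarith) m
  have h5 := h.len_rpow_mul_norm_le (s := a + 1) (by linarith) (by linarith) (k - m)
  calc len k ^ a * (|adKer m (k - m)| * ‖f m‖ * ‖f (k - m)‖)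
      = (|adKer m (k - m)| * len k ^ a) * (‖f m‖ * ‖f (k - m)‖) := by ring
    _ ≤ (4 * (len m ^ (a + 1) + len (k - m) ^ (a + 1))) * (‖f m‖ * ‖f (k - m)‖) := by gcongr
    _ = 4 * ((len m ^ (a + 1) * ‖f m‖) * ‖f (k - m)‖ +
          (len (k - m) ^ (a + 1) * ‖f (k - m)‖) * ‖f m‖) := by ring
    _ ≤ 4 * (M * ‖f (k - m)‖ + M * ‖f m‖) := by gcongr
    _ = 4 * M * (‖f m‖ + ‖f (k - m)‖) := by ring

/-- Continuity of each coefficient does not make the full norm continuous in time, but the norm is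
measurable as a limit of partial sums, and it is bounded. -/
lemma intervalIntegrable_hs_pow {T s M : ℝ} {c : ℝ → Freq → ℂ}
    (hc : ∀ k, ContinuousOn (fun t => c t k) (Icc 0 T)) (hf : ∀ t ∈ Icc 0 T, FiniteHs s (c t))
    (hM : ∀ t ∈ Icc 0 T, hs s (c t) ≤ M) (hT : 0 ≤ T) (n : ℕ) :
    IntervalIntegrable (fun t => hs s (c t) ^ n) volume 0 T := by
  have hm : AEStronglyMeasurable
      (fun t => ∑' k : Freq, len k ^ (2 * s) * ‖c t k‖ ^ 2) (volume.restrict (Ioc 0 T)) := by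
    refine aestronglyMeasurable_of_tendsto_ae (Filter.atTop : Filter (Finset Freq))
      (f := fun F t => ∑ k ∈ F, len k ^ (2 * s) * ‖c t k‖ ^ 2) (fun F => ?_) ?_
    · have h1 : ContinuousOn (fun t => ∑ k ∈ F, len k ^ (2 * s) * ‖c t k‖ ^ 2) (Icc 0 T) :=
        continuousOn_finsetSum _ fun k _ => continuousOn_const.mul ((hc k).norm.pow 2)
      exact (h1.mono Ioc_subset_Icc_self).aestronglyMeasurable measurableSet_Ioc
    · exact (ae_restrict_iff' measurableSet_Ioc).2 (Filter.Eventually.of_forall fun t ht =>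
        (hf t (Ioc_subset_Icc_self ht)).hasSum)
  have hm2 : AEStronglyMeasurable (fun t => hs s (c t) ^ n) (volume.restrict (Ioc 0 T)) :=
    (Real.continuous_sqrt.comp_aestronglyMeasurable hm).pow n
  rw [intervalIntegrable_iff_integrableOn_Ioc_of_le hT]
  refine Integrable.of_bound hm2 (M ^ n) ?_
  refine (ae_restrict_iff' measurableSet_Ioc).2 (Filter.Eventually.of_forall fun t ht => ?_)
  rw [Real.norm_of_nonneg (pow_nonneg (hs_nonneg _ _) n)]
  exact pow_le_pow_left₀ (hs_nonneg _ _) (hM t (Ioc_subset_Icc_self ht)) n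

/-! ### Norms of functions and of their Fourier coefficients -/

lemma sobNorm_eq (s : ℝ) (f : Box → ℝ) : sobNorm s f = 2 * Real.pi * hs s (rcoeff f) := by
  rw [sobNorm, Real.sqrt_mul (by positivity), Real.sqrt_sq Real.two_pi_pos.le, hs]

lemma one_le_two_pi : 1 ≤ 2 * Real.pi := by linarith [Real.pi_gt_three]

lemma hs_le_sobNorm (s : ℝ) (f : Box → ℝ) : hs s (rcoeff f) ≤ sobNorm s f := by
  rw [sobNorm_eq]
  exact le_mul_of_one_le_left (hs_nonneg _ _) one_le_two_pi

lemma sobNorm_nonneg (s : ℝ) (f : Box → ℝ) : 0 ≤ sobNorm s f := Real.sqrt_nonneg _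

lemma MemHs.finiteHs {s : ℝ} {f : Box → ℝ} (h : MemHs s f) : FiniteHs s (rcoeff f) := h.2

lemma FiniteHs.sub {s : ℝ} {f g : Freq → ℂ} (hf : FiniteHs s f) (hg : FiniteHs s g) :
    FiniteHs s fun k => f k - g k := by
  refine Summable.of_nonneg_of_le (fun k => mul_nonneg (len_rpow_nonneg k _) (sq_nonneg _))
    (fun k => ?_) ((hf.mul_left 2).add (hg.mul_left 2))
  have h1 : ‖f k - g k‖ ^ 2 ≤ 2 * ‖f k‖ ^ 2 + 2 * ‖g k‖ ^ 2 := by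
    have := norm_sub_le (f k) (g k)
    nlinarith [norm_nonneg (f k - g k), sq_nonneg (‖f k‖ - ‖g k‖)]
  calc len k ^ (2 * s) * ‖f k - g k‖ ^ 2
      ≤ len k ^ (2 * s) * (2 * ‖f k‖ ^ 2 + 2 * ‖g k‖ ^ 2) :=
        mul_le_mul_of_nonneg_left h1 (len_rpow_nonneg k _)
    _ = _ := by ring

lemma FiniteHs.summable_one_add_len_mul {f : Freq → ℂ} (h : FiniteHs 3 f) :
    Summable fun k => (1 + len k) * ‖f k‖ := by
  refine Summable.of_norm_bounded_eventually (h.len_lone.1.mul_left 2) ?_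
  refine (Set.finite_singleton (0 : Freq)).subset fun k hk => ?_
  by_contra h0
  apply hk
  change ‖(1 + len k) * ‖f k‖‖ ≤ 2 * (len k * ‖f k‖)
  rw [Real.norm_of_nonneg (mul_nonneg (one_add_len_pos k).le (norm_nonneg _)), ← mul_assoc]
  gcongr
  linarith [one_le_len h0]

lemma FiniteHs.decay {f : Freq → ℂ} {M₀ M : ℝ} (h : FiniteHs 3 f) (h0 : ‖f 0‖ ≤ M₀)
    (hM : hs 3 f ≤ M) : Decay (M₀ + 8 * M) f := by
  have hM0 : 0 ≤ M₀ := (norm_nonneg _).trans h0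
  have hM1 : 0 ≤ M := (hs_nonneg _ _).trans hM
  intro k
  have hp := one_add_len_pos k
  rw [← div_eq_mul_inv, le_div_iff₀ (by positivity)]
  by_cases hk : k = 0
  · subst hk
    simp only [len_zero, add_zero, one_pow, mul_one]
    linarith
  · have h1 := h.len_rpow_mul_le k
    have h2 : len k ^ (3 : ℝ) = len k ^ 3 := by norm_cast
    rw [h2] at h1
    have h3 : (1 + len k) ^ 3 ≤ (2 * len k) ^ 3 := by
      gcongr
      linarith [one_le_len hk]
    calc ‖f k‖ * (1 + len k) ^ 3 ≤ ‖f k‖ * (2 * len k) ^ 3 := by gcongr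
      _ = 8 * (len k ^ 3 * ‖f k‖) := by ring
      _ ≤ M₀ + 8 * M := by linarith

lemma gap_eq {μ α s : ℝ} {f g : Box → ℝ} (hα0 : 0 < α) (hαs : α ≤ s) (hf : MemHs s f)
    (hg : MemHs s g) :
    (Summable fun k => (1 + μ * len k ^ (2 * α)) * ‖rcoeff f k - rcoeff g k‖ ^ 2) ∧
    gap μ α f g = (2 * Real.pi) ^ 2 *
      ∑' k, (1 + μ * len k ^ (2 * α)) * ‖rcoeff f k - rcoeff g k‖ ^ 2 := by
  have h1 := hasSum_norm_rcoeff_sq (hf.1.sub hg.1)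
  have hr : rcoeff (f - g) = fun k => rcoeff f k - rcoeff g k :=
    funext fun k => rcoeff_sub hf.1 hg.1 k
  simp only [hr, Pi.sub_apply] at h1
  have h2 : Summable fun k => ‖rcoeff f k - rcoeff g k‖ ^ 2 :=
    (summable_mul_left_iff (by positivity)).1 h1.summable
  have h3 : FiniteHs α fun k => rcoeff f k - rcoeff g k :=
    (hf.finiteHs.mono hα0 hαs).sub (hg.finiteHs.mono hα0 hαs)
  have h4 : Summable fun k => μ * (len k ^ (2 * α) * ‖rcoeff f k - rcoeff g k‖ ^ 2) :=
    h3.mul_left μ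
  have h5 : ∀ k, (1 + μ * len k ^ (2 * α)) * ‖rcoeff f k - rcoeff g k‖ ^ 2 =
      ‖rcoeff f k - rcoeff g k‖ ^ 2 + μ * (len k ^ (2 * α) * ‖rcoeff f k - rcoeff g k‖ ^ 2) :=
    fun k => by ring
  simp only [h5]
  refine ⟨h2.add h4, ?_⟩
  have hl : l2norm (fun x => f x - g x) ^ 2 =
      (2 * Real.pi) ^ 2 * ∑' k, ‖rcoeff f k - rcoeff g k‖ ^ 2 := by
    rw [l2norm, Real.sq_sqrt (integral_nonneg fun x => sq_nonneg _), ← h1.tsum_eq, tsum_mul_left]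
  have hr' : rcoeff (fun x => f x - g x) = fun k => rcoeff f k - rcoeff g k := hr
  rw [gap, hl, sobNorm_eq, hr', mul_pow _ (hs _ _), hs_sq, h2.tsum_add h4, tsum_mul_left]
  ring

/-! ### Solutions in Fourier space -/

/-- The Fourier coefficients of a solution of the regularized equation, with the bounds that
membership in `L^∞([0,T]; H^s)` gives. The case `μ = 0` is the quasi-geostrophic equation. -/
structure CoeffSolution (μ α s T D M : ℝ) (c : ℝ → Freq → ℂ) : Prop where
  decay : ∀ t ∈ Icc 0 T, Decay D (c t)
  finite : ∀ t ∈ Icc 0 T, FiniteHs s (c t)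
  hs_le : ∀ t ∈ Icc 0 T, hs s (c t) ≤ M
  cont : ∀ k, ContinuousOn (fun t => c t k) (Icc 0 T)
  real : ∀ t ∈ Icc 0 T, ∀ k, c t (-k) = (starRingEnd ℂ) (c t k)
  eqn : ∀ t ∈ Icc 0 T, ∀ k, c t k = c 0 k +
    ∫ τ in (0 : ℝ)..t, -(((1 + μ * len k ^ (2 * α) : ℝ) : ℂ)⁻¹ * adv (c τ) (c τ) k)

lemma viscosity_pos {μ : ℝ} (hμ : 0 ≤ μ) (α : ℝ) (k : Freq) : 0 < 1 + μ * len k ^ (2 * α) := by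
  have := mul_nonneg hμ (len_rpow_nonneg k (2 * α))
  linarith

lemma IsQGSolution.isRegularizedSolution {s T : ℝ} {θ₀ : Box → ℝ} {θ : ℝ → Box → ℝ}
    (h : IsQGSolution s T θ₀ θ) (α : ℝ) : IsRegularizedSolution 0 α s T θ₀ θ where
  memHs := h.memHs
  bounded := h.bounded
  integrable := h.integrable
  equation t ht k := by simpa using h.equation t ht k

lemma IsRegularizedSolution.rcoeff_zero {μ α s T : ℝ} {θ₀ : Box → ℝ} {θ : ℝ → Box → ℝ}
    (h : IsRegularizedSolution μ α s T θ₀ θ) (hμ : 0 ≤ μ) (hT : 0 ≤ T) :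
    rcoeff (θ 0) = rcoeff θ₀ := by
  funext k
  have h1 := h.equation 0 ⟨le_rfl, hT⟩ k
  rw [intervalIntegral.integral_same, add_zero, mul_eq_zero] at h1
  rcases h1 with h1 | h1
  · exact absurd (Complex.ofReal_eq_zero.1 h1) (viscosity_pos hμ α k).ne'
  · exact sub_eq_zero.1 h1

lemma IsRegularizedSolution.exists_coeffSolution {μ α s T : ℝ} {θ₀ : Box → ℝ}
    {θ : ℝ → Box → ℝ} (h : IsRegularizedSolution μ α s T θ₀ θ) (hs3 : 3 ≤ s) (hμ : 0 ≤ μ)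
    (hT : 0 ≤ T) : ∃ D M, CoeffSolution μ α s T D M fun t => rcoeff (θ t) := by
  obtain ⟨M, hM⟩ := h.bounded
  have hfin : ∀ t ∈ Icc 0 T, FiniteHs s (rcoeff (θ t)) := fun t ht => (h.memHs t ht).finiteHs
  have hfin3 : ∀ t ∈ Icc 0 T, FiniteHs 3 (rcoeff (θ t)) := fun t ht =>
    (hfin t ht).mono (by norm_num) hs3
  have hMs : ∀ t ∈ Icc 0 T, hs s (rcoeff (θ t)) ≤ M := fun t ht =>
    (hs_le_sobNorm _ _).trans (hM t ht)
  have hadv : ∀ t ∈ Icc 0 T, ∀ k,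
      coeff (advection (θ t)) k = adv (rcoeff (θ t)) (rcoeff (θ t)) k := fun t ht k =>
    coeff_advection (hfin3 t ht).summable_one_add_len_mul k
  have h0 := h.rcoeff_zero hμ hT
  have heq : ∀ t ∈ Icc 0 T, ∀ k, rcoeff (θ t) k = rcoeff (θ 0) k +
      ∫ τ in (0 : ℝ)..t, -(((1 + μ * len k ^ (2 * α) : ℝ) : ℂ)⁻¹ * coeff (advection (θ τ)) k) := by
    intro t ht k
    have h1 := h.equation t ht k
    have h2 : ((1 + μ * len k ^ (2 * α) : ℝ) : ℂ) ≠ 0 :=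
      Complex.ofReal_ne_zero.2 (viscosity_pos hμ α k).ne'
    rw [intervalIntegral.integral_neg, intervalIntegral.integral_const_mul, h0]
    linear_combination ((1 + μ * len k ^ (2 * α) : ℝ) : ℂ)⁻¹ * h1 -
      (rcoeff (θ t) k - rcoeff θ₀ k) * inv_mul_cancel₀ h2
  have hcont : ∀ k, ContinuousOn (fun t => rcoeff (θ t) k) (Icc 0 T) := by
    intro k
    have h1 := intervalIntegral.continuousOn_primitive_interval'
      ((h.integrable k).const_mul (((1 + μ * len k ^ (2 * α) : ℝ) : ℂ)⁻¹)).neg left_mem_uIcc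
    rw [uIcc_of_le hT] at h1
    exact (continuousOn_const.add h1).congr fun t ht => heq t ht k
  -- The homogeneous norm does not see the mean value; its bound comes from continuity in time on a
  -- compact interval.
  obtain ⟨M₀, hM₀⟩ := isCompact_Icc.exists_bound_of_continuousOn (hcont 0)
  refine ⟨M₀ + 8 * M, M, fun t ht => ?_, hfin, hMs, hcont, fun t _ k => rcoeff_neg _ k,
    fun t ht k => ?_⟩
  · exact (hfin3 t ht).decay (hM₀ t ht) ((hs_mono (by norm_num) hs3 (hfin t ht)).trans (hMs t ht))
  · rw [heq t ht k]
    congr 1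
    refine intervalIntegral.integral_congr fun τ hτ => ?_
    rw [uIcc_of_le ht.1] at hτ
    simp only [hadv τ ⟨hτ.1, hτ.2.trans ht.2⟩ k]

lemma norm_adv_le_of_decay {D a : ℝ} {f : Freq → ℂ} (h : Decay D f) (ha0 : 0 ≤ a) (ha2 : a ≤ 2)
    (k : Freq) : len k ^ a * ‖adv f f k‖ ≤ 8 * D * (D * ∑' k, ((1 + len k) ^ 3)⁻¹) := by
  refine (norm_adv_le h ha0 ha2 k).trans ?_
  have h1 := h.nonneg
  rw [← tsum_mul_left (a := D)]
  refine mul_le_mul_of_nonneg_left ?_ (by positivity)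
  exact h.summable.tsum_le_tsum h (summable_inv_one_add_len_cube.mul_left D)

/-! ### The difference of two solutions -/

/-- The energy production for the difference `w = a - b` of two solutions. -/
lemma difference_rate {μ α s A B : ℝ} {a b : Freq → ℂ} (hα0 : 0 < α) (hα1 : α ≤ 1)
    (hs3 : 3 ≤ s) (hμ : 0 ≤ μ) (ha : Decay A a) (hb : Decay B b)
    (har : ∀ k, a (-k) = (starRingEnd ℂ) (a k)) (hbr : ∀ k, b (-k) = (starRingEnd ℂ) (b k))
    (hbs : FiniteHs s b) :
    2 * (∑' k, (-adv a a k + ((1 + μ * len k ^ (2 * α) : ℝ) : ℂ) * adv b b k) *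
        (starRingEnd ℂ) (a k - b k)).re ≤
      (2 * latticeConst 2 * hs s b + 1) * hs 0 (fun k => a k - b k) ^ 2 +
        64 * latticeConst (2 * α + 1) ^ 2 * μ ^ 2 * hs (2 * α + 1) b ^ 4 := by
  set w : Freq → ℂ := fun k => a k - b k with hw
  have hwd : Decay (A + B) w := ha.sub hb
  have hwr : ∀ k, w (-k) = (starRingEnd ℂ) (w k) := fun k => by simp [hw, har, hbr]
  have hb3 : FiniteHs 3 b := hbs.mono (by norm_num) hs3
  obtain ⟨hv1, hv2⟩ := tri_viscous (a := 2 * α) (by linarith) (by linarith)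
    (hbs.mono (by linarith) (by linarith)) hwd.summable_sq
  have hs1 := hasSum_adv_mul_conj_of_decay ha ha hwd
  have hs2 := hasSum_adv_mul_conj_of_decay hb hb hwd
  have hs3' := hasSum_adv_mul_conj (h := fun k => ((len k ^ (2 * α) : ℝ) : ℂ) * w k) hv1
    (summable_adv_term hb hb)
  have hsum : HasSum (fun k => (-adv a a k + ((1 + μ * len k ^ (2 * α) : ℝ) : ℂ) * adv b b k) *
      (starRingEnd ℂ) (w k))
      (-tri a a w + tri b b w + μ * tri b b fun k => ((len k ^ (2 * α) : ℝ) : ℂ) * w k) := by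
    refine HasSum.congr_fun ((hs1.neg.add hs2).add (hs3'.mul_left (μ : ℂ))) fun k => ?_
    simp only [map_mul, Complex.conj_ofReal]
    push_cast
    ring
  -- The splitting `a a - b b = a w + w b`, in which `tri a w w` vanishes by skew-symmetry.
  have htri : tri a a w - tri b b w = tri w b w := by
    have h0 := tri_self (f := a) hwr
    rw [← zero_add (tri w b w), ← h0]
    simp only [tri]
    rw [← (summable_tri ha ha hwd).tsum_sub (summable_tri hb hb hwd),
      ← (summable_tri ha hwd hwd).tsum_add (summable_tri hwd hb hwd)]
    refine tsum_congr fun p => ?_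
    simp only [hw]
    ring
  have e1 := norm_tri_le_of_lipschitz hwd.summable_sq hb3
  have e2 := hs_mono (by norm_num) hs3 hbs
  rw [hsum.tsum_eq, show -tri a a w + tri b b w = -tri w b w by rw [← htri]; ring]
  set Q := hs (2 * α + 1) b ^ 2
  set L := latticeConst (2 * α + 1)
  set W := hs 0 w
  have hW : 0 ≤ W := hs_nonneg _ _
  have r1 : (-tri w b w + μ * tri b b fun k => ((len k ^ (2 * α) : ℝ) : ℂ) * w k).re ≤
      latticeConst 2 * hs s b * W ^ 2 + μ * (8 * L * Q * W) := by
    refine (Complex.re_le_norm _).trans ((norm_add_le _ _).trans ?_)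
    rw [norm_neg, norm_mul, Complex.norm_real, Real.norm_of_nonneg hμ]
    have := latticeConst_nonneg 2
    gcongr
    exact e1.trans (by gcongr)
  -- Completing the square leaves a source quadratic in `μ`; the `W ^ 2` it costs is the `+ 1` in
  -- the coefficient.
  have r2 : 2 * (μ * (8 * L * Q * W)) ≤ W ^ 2 + 64 * L ^ 2 * μ ^ 2 * Q ^ 2 := by
    nlinarith [sq_nonneg (W - 8 * L * μ * Q)]
  have r3 : hs (2 * α + 1) b ^ 4 = Q ^ 2 := by simp only [Q]; ring
  rw [r3]
  linarith

/-- The constant of the difference estimate. -/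
def gapConst (α₀ : ℝ) : ℝ := 2 * latticeConst 2 + 1 + 64 * latticeConst (2 * α₀ + 1) ^ 2

lemma one_le_gapConst (α₀ : ℝ) : 1 ≤ gapConst α₀ := by
  have := latticeConst_nonneg 2
  unfold gapConst
  nlinarith [sq_nonneg (latticeConst (2 * α₀ + 1))]

theorem gap_le {α₀ α s μ T : ℝ} (hα₀ : 0 < α₀) (hα : α₀ ≤ α) (hα1 : α ≤ 1) (hs3 : 3 ≤ s)
    (hμ : 0 < μ) {θ₀μ θ₀ : Box → ℝ} {θμ θ : ℝ → Box → ℝ} (h₀μ : MemHs s θ₀μ)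
    (h₀ : MemHs s θ₀) (hθμ : IsRegularizedSolution μ α s T θ₀μ θμ) (hθ : IsQGSolution s T θ₀ θ)
    {t : ℝ} (ht : t ∈ Icc 0 T) :
    gap μ α (θμ t) (θ t) ≤
      gap μ α θ₀μ θ₀ * Real.exp (gapConst α₀ * ∫ τ in (0 : ℝ)..t, (1 + sobNorm s (θ τ))) +
        gapConst α₀ * μ ^ 2 * ∫ ζ in (0 : ℝ)..t,
          Real.exp (gapConst α₀ * ∫ τ in ζ..t, (1 + sobNorm s (θ τ))) *
            sobNorm (2 * α + 1) (θ ζ) ^ 4 := by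
  have hT : 0 ≤ T := ht.1.trans ht.2
  have hα0 : 0 < α := hα₀.trans_le hα
  have hθ' := hθ.isRegularizedSolution α
  obtain ⟨A, _, ha⟩ := hθμ.exists_coeffSolution hs3 hμ.le hT
  obtain ⟨B, M, hb⟩ := hθ'.exists_coeffSolution hs3 le_rfl hT
  set a : ℝ → Freq → ℂ := fun t => rcoeff (θμ t) with ha_def
  set b : ℝ → Freq → ℂ := fun t => rcoeff (θ t) with hb_def
  set C := gapConst α₀ with hC
  have hC1 : 1 ≤ C := one_le_gapConst α₀
  set p : Freq → ℝ := fun k => 1 + μ * len k ^ (2 * α) with hp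
  have hp0 : ∀ k, 0 < p k := viscosity_pos hμ.le α
  have hpc : ∀ k, (p k : ℂ) ≠ 0 := fun k => Complex.ofReal_ne_zero.2 (hp0 k).ne'
  set d : ℝ → Freq → ℂ := fun t k =>
    -((p k : ℂ)⁻¹ * adv (a t) (a t) k) + adv (b t) (b t) k with hd_def
  have hca := fun k => continuousOn_adv ha.decay ha.cont k
  have hcb := fun k => continuousOn_adv hb.decay hb.cont k
  have hca' : ∀ k, ContinuousOn (fun t => -((p k : ℂ)⁻¹ * adv (a t) (a t) k)) (Icc 0 T) :=
    fun k => (continuousOn_const.mul (hca k)).neg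
  have hd : ∀ k, ContinuousOn (fun t => d t k) (Icc 0 T) := fun k => (hca' k).add (hcb k)
  have hsubT : ∀ u ∈ Icc 0 T, uIcc 0 u ⊆ Icc 0 T := fun u hu => by
    rw [uIcc_of_le hu.1]; exact Icc_subset_Icc_right hu.2
  have hc : ∀ u ∈ Icc 0 T, ∀ k, a u k - b u k = a 0 k - b 0 k + ∫ τ in (0 : ℝ)..u, d τ k := by
    intro u hu k
    have e1 := ha.eqn u hu k
    have e2 := hb.eqn u hu k
    simp only [zero_mul, add_zero, Complex.ofReal_one, inv_one, one_mul,
      intervalIntegral.integral_neg] at e2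
    simp only [hd_def]
    rw [intervalIntegral.integral_add ((hca' k).mono (hsubT u hu)).intervalIntegrable
      ((hcb k).mono (hsubT u hu)).intervalIntegrable]
    linear_combination e1 - e2
  have hpd : ∀ τ k, (p k : ℂ) * d τ k = -adv (a τ) (a τ) k + (p k : ℂ) * adv (b τ) (b τ) k := by
    intro τ k
    simp only [hd_def]
    linear_combination (-adv (a τ) (a τ) k) * mul_inv_cancel₀ (hpc k)
  set Λ : ℝ := ∑' k, ((1 + len k) ^ 3)⁻¹
  have hbound : ∀ u ∈ Icc 0 T, ∀ k, ‖(p k : ℂ) * d u k * (starRingEnd ℂ) (a u k - b u k)‖ ≤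
      (8 * A * (A * Λ) + (8 * B * (B * Λ) + μ * (8 * B * (B * Λ)))) *
        ((A + B) * ((1 + len k) ^ 3)⁻¹) := by
    intro u hu k
    have n1 := norm_adv_le_of_decay (ha.decay u hu) (a := 0) le_rfl (by norm_num) k
    have n2 := norm_adv_le_of_decay (hb.decay u hu) (a := 0) le_rfl (by norm_num) k
    have n3 := norm_adv_le_of_decay (hb.decay u hu) (a := 2 * α) (by linarith) (by linarith) k
    rw [Real.rpow_zero, one_mul] at n1 n2
    have n4 := ((ha.decay u hu).sub (hb.decay u hu)) k
    have n5 : ‖(p k : ℂ) * d u k‖ ≤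
        8 * A * (A * Λ) + (8 * B * (B * Λ) + μ * (8 * B * (B * Λ))) := by
      rw [hpd]
      refine (norm_add_le _ _).trans (add_le_add (by rwa [norm_neg]) ?_)
      rw [norm_mul, Complex.norm_real, Real.norm_of_nonneg (hp0 k).le]
      simp only [hp]
      linarith [mul_le_mul_of_nonneg_left n3 hμ.le]
    rw [norm_mul, RCLike.norm_conj]
    exact mul_le_mul n5 n4 (norm_nonneg _) ((norm_nonneg _).trans n5)
  have hgap : ∀ u ∈ Icc 0 T,
      (Summable fun k => p k * ‖a u k - b u k‖ ^ 2) ∧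
        gap μ α (θμ u) (θ u) = (2 * Real.pi) ^ 2 * ∑' k, p k * ‖a u k - b u k‖ ^ 2 :=
    fun u hu => gap_eq hα0 (by linarith) (hθμ.memHs u hu) (hθ.memHs u hu)
  obtain ⟨hGc, hE⟩ := energy_identity (c := fun t k => a t k - b t k) hd hc hbound
    ((summable_inv_one_add_len_cube.mul_left _).mul_left _) fun u hu => (hgap u hu).1
  simp only [hpd] at hGc hE
  set G : ℝ → ℝ := fun τ => 2 * (∑' k, (-adv (a τ) (a τ) k + (p k : ℂ) * adv (b τ) (b τ) k) *
    (starRingEnd ℂ) (a τ k - b τ k)).re with hG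
  have hgap0 : gap μ α θ₀μ θ₀ = (2 * Real.pi) ^ 2 * ∑' k, p k * ‖a 0 k - b 0 k‖ ^ 2 := by
    rw [(gap_eq hα0 (by linarith) h₀μ h₀).2]
    simp only [ha_def, hb_def, hθμ.rcoeff_zero hμ.le hT, hθ'.rcoeff_zero le_rfl hT, hp]
  have hgapt : ∀ u ∈ Icc 0 T,
      gap μ α (θμ u) (θ u) = gap μ α θ₀μ θ₀ + ∫ τ in (0 : ℝ)..u, (2 * Real.pi) ^ 2 * G τ := by
    intro u hu
    have h1 : ∫ τ in (0 : ℝ)..u, (2 * Real.pi) ^ 2 * G τ =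
        (2 * Real.pi) ^ 2 * ∫ τ in (0 : ℝ)..u, G τ := intervalIntegral.integral_const_mul _ _
    rw [(hgap u hu).2, hE u hu, hgap0, h1]
    ring
  have hst : Icc 0 t ⊆ Icc 0 T := Icc_subset_Icc_right ht.2
  have hfin : ∀ u ∈ Icc 0 t, FiniteHs s (b u) := fun u hu => hb.finite u (hst hu)
  have hint1 := intervalIntegrable_hs_pow (fun k => (hb.cont k).mono hst) hfin
    (fun u hu => hb.hs_le u (hst hu)) ht.1 1
  have hint4 := intervalIntegrable_hs_pow (s := 2 * α + 1) (fun k => (hb.cont k).mono hst)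
    (fun u hu => (hfin u hu).mono (by linarith) (by linarith))
    (fun u hu => (hs_mono (by linarith) (by linarith) (hfin u hu)).trans (hb.hs_le u (hst hu)))
    ht.1 4
  simp only [pow_one] at hint1
  have hGr := gronwall_integral (t := t) (B := C * (1 + 2 * Real.pi * M))
    (E₀ := gap μ α θ₀μ θ₀) (G := fun τ => (2 * Real.pi) ^ 2 * G τ)
    (h := fun τ => C * (1 + sobNorm s (θ τ)))
    (q := fun τ => C * μ ^ 2 * sobNorm (2 * α + 1) (θ τ) ^ 4) ht.1
    (by
      refine ContinuousOn.intervalIntegrable ?_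
      rw [uIcc_of_le ht.1]
      exact continuousOn_const.mul (hGc.mono hst))
    (by
      simp only [sobNorm_eq]
      exact (intervalIntegrable_const.add (hint1.const_mul _)).const_mul C)
    (by
      simp only [sobNorm_eq, mul_pow]
      exact (hint4.const_mul _).const_mul _)
    (fun u _ => by
      have := sobNorm_nonneg s (θ u)
      positivity)
    (fun u hu => by
      have h1 := hb.hs_le u (hst hu)
      simp only [sobNorm_eq]
      gcongr)
    (fun u hu => by
      have huT := hst hu
      rw [← hgapt u huT, (hgap u huT).2]
      have r := difference_rate (μ := μ) hα0 hα1 hs3 hμ.le (ha.decay u huT) (hb.decay u huT)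
        (ha.real u huT) (hb.real u huT) (hb.finite u huT)
      have hW : hs 0 (fun k => a u k - b u k) ^ 2 ≤ ∑' k, p k * ‖a u k - b u k‖ ^ 2 := by
        rw [hs_sq]
        simp only [mul_zero, Real.rpow_zero, one_mul]
        refine ((ha.decay u huT).sub (hb.decay u huT)).summable_sq.tsum_le_tsum (fun k => ?_)
          (hgap u huT).1
        refine le_mul_of_one_le_left (sq_nonneg _) ?_
        have := mul_nonneg hμ.le (len_rpow_nonneg k (2 * α))
        simp only [hp]
        linarith
      have hL := latticeConst_nonneg 2
      have hL0 : latticeConst (2 * α + 1) ^ 2 ≤ latticeConst (2 * α₀ + 1) ^ 2 :=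
        pow_le_pow_left₀ (latticeConst_nonneg _)
          (latticeConst_anti (by linarith) (by linarith)) 2
      have hsn := hs_nonneg s (b u)
      have hC2 : 64 * latticeConst (2 * α + 1) ^ 2 ≤ C := by
        simp only [hC, gapConst]
        linarith
      have hC3 : 2 * latticeConst 2 * hs s (b u) + 1 ≤ C * (1 + sobNorm s (θ u)) := by
        have h1 : hs s (b u) ≤ sobNorm s (θ u) := hs_le_sobNorm _ _
        have h2 : 2 * latticeConst 2 ≤ C := by
          simp only [hC, gapConst]
          nlinarith [sq_nonneg (latticeConst (2 * α₀ + 1))]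
        have h3 : 2 * latticeConst 2 * hs s (b u) ≤ C * sobNorm s (θ u) :=
          mul_le_mul h2 h1 hsn (by linarith)
        linarith
      -- The gap carries `(2π)²` and the fourth power of the norm carries `(2π)⁴`; the surplus is at
      -- least 1.
      have h4 : (2 * Real.pi) ^ 2 * hs (2 * α + 1) (b u) ^ 4 ≤ sobNorm (2 * α + 1) (θ u) ^ 4 := by
        rw [sobNorm_eq, mul_pow _ (hs _ _)]
        exact mul_le_mul_of_nonneg_right (pow_le_pow_right₀ one_le_two_pi (by norm_num))
          (pow_nonneg (hs_nonneg _ _) 4)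
      have hr2 : G u ≤ C * (1 + sobNorm s (θ u)) * (∑' k, p k * ‖a u k - b u k‖ ^ 2) +
          C * μ ^ 2 * hs (2 * α + 1) (b u) ^ 4 := by
        refine r.trans (add_le_add ?_ ?_)
        · exact mul_le_mul hC3 hW (sq_nonneg _)
            (mul_nonneg (by linarith) (by linarith [sobNorm_nonneg s (θ u)]))
        · have := pow_nonneg (hs_nonneg (2 * α + 1) (b u)) 4
          gcongr
      calc (2 * Real.pi) ^ 2 * G u
          ≤ (2 * Real.pi) ^ 2 * (C * (1 + sobNorm s (θ u)) *
              (∑' k, p k * ‖a u k - b u k‖ ^ 2) + C * μ ^ 2 * hs (2 * α + 1) (b u) ^ 4) := by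
            gcongr
        _ = C * (1 + sobNorm s (θ u)) * ((2 * Real.pi) ^ 2 *
              ∑' k, p k * ‖a u k - b u k‖ ^ 2) +
              C * μ ^ 2 * ((2 * Real.pi) ^ 2 * hs (2 * α + 1) (b u) ^ 4) := by ring
        _ ≤ _ := by gcongr)
  rw [← hgapt t ht] at hGr
  have h7 : ∫ ζ in (0 : ℝ)..t, Real.exp (∫ τ in ζ..t, C * (1 + sobNorm s (θ τ))) *
      (C * μ ^ 2 * sobNorm (2 * α + 1) (θ ζ) ^ 4) =
      C * μ ^ 2 * ∫ ζ in (0 : ℝ)..t, Real.exp (C * ∫ τ in ζ..t, (1 + sobNorm s (θ τ))) *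
        sobNorm (2 * α + 1) (θ ζ) ^ 4 := by
    rw [← intervalIntegral.integral_const_mul (C * μ ^ 2)]
    congr 1
    funext ζ
    rw [intervalIntegral.integral_const_mul]
    ring
  rwa [h7, intervalIntegral.integral_const_mul] at hGr

/-! ### The bound on the interval that the size of the initial value guarantees -/

/-- The constant in `d/dt ‖θ‖_s² ≤ C ‖θ‖_s³`. -/
def growthConst (s : ℝ) : ℝ := 2 * (2 * (s * 2 ^ (s - 1)) * latticeConst 2)

lemma growthConst_nonneg {s : ℝ} (hs : 0 ≤ s) : 0 ≤ growthConst s := by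
  have := latticeConst_nonneg 2
  unfold growthConst
  positivity

/-- The energy identity is applied with the bounded weight `cutWeight s R k ^ 2`; its production is
bounded independently of `R`, so the cutoff can be removed. -/
lemma CoeffSolution.hs_sq_le {α s T D M : ℝ} {c : ℝ → Freq → ℂ}
    (h : CoeffSolution 0 α s T D M c) (hs3 : 3 ≤ s) {t : ℝ} (ht : t ∈ Icc 0 T) :
    hs s (c t) ^ 2 ≤ hs s (c 0) ^ 2 + growthConst s * ∫ τ in (0 : ℝ)..t, hs s (c τ) ^ 3 := by
  have hT : 0 ≤ T := ht.1.trans ht.2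
  have h0 : (0 : ℝ) ∈ Icc 0 T := ⟨le_rfl, hT⟩
  have hst : Icc 0 t ⊆ Icc 0 T := Icc_subset_Icc_right ht.2
  have hint := intervalIntegrable_hs_pow (fun k => (h.cont k).mono hst)
    (fun u hu => h.finite u (hst hu)) (fun u hu => h.hs_le u (hst hu)) ht.1 3
  have key : ∀ R : ℝ, 0 ≤ R → ∑' k, cutWeight s R k ^ 2 * ‖c t k‖ ^ 2 ≤
      hs s (c 0) ^ 2 + growthConst s * ∫ τ in (0 : ℝ)..t, hs s (c τ) ^ 3 := by
    intro R hR
    have hφ2 : ∀ k, |cutWeight s R k ^ 2| ≤ (R ^ s) ^ 2 := fun k => by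
      rw [abs_pow]
      exact pow_le_pow_left₀ (abs_nonneg _) (abs_cutWeight_le (by linarith) hR k) 2
    have hdec : ∀ u ∈ Icc 0 T, Decay ((R ^ s) ^ 2 * D)
        fun k => ((cutWeight s R k ^ 2 : ℝ) : ℂ) * c u k := fun u hu =>
      (h.decay u hu).real_mul hφ2
    have hle : ∀ k, cutWeight s R k ^ 2 * ‖c 0 k‖ ^ 2 ≤ len k ^ (2 * s) * ‖c 0 k‖ ^ 2 := by
      intro k
      rw [← len_rpow_mul_sq, mul_pow]
      have := cutWeight_nonneg (s := s) hR k
      gcongr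
      exact cutWeight_le (by linarith) hR k
    have hsumm : ∀ u ∈ Icc 0 T, Summable fun k => cutWeight s R k ^ 2 * ‖c u k‖ ^ 2 := by
      intro u hu
      refine Summable.of_nonneg_of_le (fun k => by positivity) (fun k => ?_)
        ((h.decay u hu).summable_sq.mul_left ((R ^ s) ^ 2))
      exact mul_le_mul_of_nonneg_right ((le_abs_self _).trans (hφ2 k)) (sq_nonneg _)
    have hbound : ∀ u ∈ Icc 0 T, ∀ k, ‖((cutWeight s R k ^ 2 : ℝ) : ℂ) * -adv (c u) (c u) k *
        (starRingEnd ℂ) (c u k)‖ ≤ 8 * D * (D * ∑' k, ((1 + len k) ^ 3)⁻¹) *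
          ((R ^ s) ^ 2 * D * ((1 + len k) ^ 3)⁻¹) := by
      intro u hu k
      have n1 := norm_adv_le_of_decay (h.decay u hu) (a := 0) le_rfl (by norm_num) k
      rw [Real.rpow_zero, one_mul] at n1
      have n2 := hdec u hu k
      rw [norm_mul] at n2
      rw [mul_comm (((cutWeight s R k ^ 2 : ℝ) : ℂ)), mul_assoc, norm_mul, norm_neg, norm_mul,
        RCLike.norm_conj]
      exact mul_le_mul n1 n2 (by positivity) ((norm_nonneg _).trans n1)
    have hbs : Summable fun k => 8 * D * (D * ∑' k, ((1 + len k) ^ 3)⁻¹) *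
        ((R ^ s) ^ 2 * D * ((1 + len k) ^ 3)⁻¹) :=
      (summable_inv_one_add_len_cube.mul_left _).mul_left _
    have heqn : ∀ u ∈ Icc 0 T, ∀ k, c u k = c 0 k + ∫ τ in (0 : ℝ)..u, -adv (c τ) (c τ) k :=
      fun u hu k => by simpa using h.eqn u hu k
    obtain ⟨hGc, hE⟩ := energy_identity (d := fun t k => -adv (c t) (c t) k)
      (p := fun k => cutWeight s R k ^ 2)
      (fun k => (continuousOn_adv h.decay h.cont k).neg) heqn hbound hbs hsumm
    rw [hE t ht]
    refine add_le_add ?_ ?_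
    · rw [hs_sq]
      exact (hsumm 0 h0).tsum_le_tsum hle (h.finite 0 h0)
    · rw [← intervalIntegral.integral_const_mul]
      refine intervalIntegral.integral_mono_on ht.1 ?_ (hint.const_mul _) fun u hu => ?_
      · refine ContinuousOn.intervalIntegrable ?_
        rw [uIcc_of_le ht.1]
        exact hGc.mono hst
      · have huT := hst hu
        have hsum := hasSum_adv_mul_conj_of_decay (h.decay u huT) (h.decay u huT) (hdec u huT)
        have e1 : ∑' k, ((cutWeight s R k ^ 2 : ℝ) : ℂ) * -adv (c u) (c u) k *
            (starRingEnd ℂ) (c u k) =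
            -tri (c u) (c u) fun k => ((cutWeight s R k ^ 2 : ℝ) : ℂ) * c u k := by
          rw [← hsum.neg.tsum_eq]
          refine tsum_congr fun k => ?_
          rw [map_mul, Complex.conj_ofReal]
          ring
        rw [e1]
        have e2 := norm_tri_cutWeight_le hs3 hR (h.decay u huT) (h.real u huT) (h.finite u huT)
        have e3 := Complex.re_le_norm
          (-tri (c u) (c u) fun k => ((cutWeight s R k ^ 2 : ℝ) : ℂ) * c u k)
        rw [norm_neg] at e3
        unfold growthConst
        linarith
  rw [hs_sq s (c t)]
  refine Real.tsum_le_of_sum_le (fun k => mul_nonneg (len_rpow_nonneg k _) (sq_nonneg _))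
    fun F => ?_
  -- With the cutoff equal to the sum of all lengths in `F`, truncation has no effect on `F`.
  have hR : 0 ≤ ∑ k ∈ F, len k := Finset.sum_nonneg fun k _ => len_nonneg k
  refine le_trans ?_ (key (∑ k ∈ F, len k) hR)
  have hsumm : Summable fun k => cutWeight s (∑ k ∈ F, len k) k ^ 2 * ‖c t k‖ ^ 2 := by
    refine Summable.of_nonneg_of_le (fun k => by positivity) (fun k => ?_) (h.finite t ht)
    rw [← len_rpow_mul_sq, mul_pow]
    have := cutWeight_nonneg (s := s) hR k
    gcongr
    exact cutWeight_le (by linarith) hR k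
  refine le_trans (le_of_eq (Finset.sum_congr rfl fun k hk => ?_))
    (hsumm.sum_le_tsum F fun k _ => by positivity)
  rw [← len_rpow_mul_sq, mul_pow, cutWeight,
    min_eq_left (Finset.single_le_sum (fun k _ => len_nonneg k) hk)]

/-- The time of existence guaranteed by an initial value of norm one. -/
def lifespan (s : ℝ) : ℝ := (8 * growthConst s + 1)⁻¹

lemma lifespan_pos {s : ℝ} (hs : 0 ≤ s) : 0 < lifespan s := by
  have := growthConst_nonneg hs
  unfold lifespan
  positivity

lemma IsQGSolution.sobNorm_le {s T R : ℝ} {θ₀ : Box → ℝ} {θ : ℝ → Box → ℝ}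
    (h : IsQGSolution s T θ₀ θ) (hs3 : 3 ≤ s) (hT : 0 < T) (hTR : T * R ≤ lifespan s)
    (hR : sobNorm s θ₀ ≤ R) {t : ℝ} (ht : t ∈ Icc 0 T) :
    sobNorm s (θ t) ≤ 2 * Real.pi * (2 * (lifespan s / T)) := by
  have h' := h.isRegularizedSolution 1
  obtain ⟨D, M, hc⟩ := h'.exists_coeffSolution hs3 le_rfl hT.le
  have hg := growthConst_nonneg (s := s) (by linarith)
  have hl := lifespan_pos (s := s) (by linarith)
  -- The radius is `lifespan s / T` and not `R`: it dominates the initial norm, is positive even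
  -- when `R = 0`, and makes the smallness condition independent of `T`.
  have hr : 0 < lifespan s / T := div_pos hl hT
  have h0 : hs s (rcoeff (θ 0)) ≤ lifespan s / T := by
    rw [h'.rcoeff_zero le_rfl hT.le]
    refine (hs_le_sobNorm s θ₀).trans (hR.trans ?_)
    rw [le_div_iff₀ hT]
    linarith
  have hlT : 8 * growthConst s * (lifespan s / T) * T < 3 := by
    have h1 : 8 * growthConst s * (lifespan s / T) * T = 8 * growthConst s * lifespan s := by
      field_simp
    have h2 : (8 * growthConst s + 1) * lifespan s = 1 := by
      unfold lifespan
      exact mul_inv_cancel₀ (by linarith)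
    rw [h1]
    linarith
  have key := sq_le_of_integral_cube hg hr (pow_le_pow_left₀ (hs_nonneg _ _) h0 2) hlT
    (fun t _ => hs_nonneg s (rcoeff (θ t)))
    (intervalIntegrable_hs_pow hc.cont hc.finite hc.hs_le hT.le 3)
    (fun t ht => hc.hs_sq_le hs3 ht) t ht
  rw [sobNorm_eq]
  exact mul_le_mul_of_nonneg_left key Real.two_pi_pos.le

/-! ### The rate of convergence -/

/-- The constant in the rate of convergence. -/
def rateConst (α₀ T M K : ℝ) : ℝ :=
  -- The absolute value and the final `+ 1` keep the constant positive for every real `K` and `M`.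
  (|K| + gapConst α₀ * T * M ^ 4) * Real.exp (gapConst α₀ * (T * (1 + M))) + 1

lemma rateConst_pos {α₀ T M K : ℝ} (hT : 0 < T) : 0 < rateConst α₀ T M K := by
  have := one_le_gapConst α₀
  have h4 : 0 ≤ M ^ 4 := Even.pow_nonneg (by decide) M
  unfold rateConst
  positivity

lemma gap_le_rate {α₀ α s μ T M K : ℝ} (hα₀ : 0 < α₀) (hα : α₀ ≤ α) (hα1 : α ≤ 1) (hs3 : 3 ≤ s)
    (hμ : 0 < μ) {θ₀μ θ₀ : Box → ℝ} {θμ θ : ℝ → Box → ℝ} (h₀μ : MemHs s θ₀μ)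
    (h₀ : MemHs s θ₀) (hθμ : IsRegularizedSolution μ α s T θ₀μ θμ) (hθ : IsQGSolution s T θ₀ θ)
    (hM : ∀ t ∈ Icc 0 T, sobNorm s (θ t) ≤ M) (hK : gap μ α θ₀μ θ₀ ≤ K * μ ^ 2)
    {t : ℝ} (ht : t ∈ Icc 0 T) :
    gap μ α (θμ t) (θ t) ≤ rateConst α₀ T M K * μ ^ 2 := by
  have hT : 0 ≤ T := ht.1.trans ht.2
  have h0 : (0 : ℝ) ∈ Icc 0 T := ⟨le_rfl, hT⟩
  have hM0 : 0 ≤ M := (sobNorm_nonneg _ _).trans (hM 0 h0)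
  have hC := one_le_gapConst α₀
  set C := gapConst α₀ with hC_def
  have hexp : ∀ ζ ∈ Icc 0 t, Real.exp (C * ∫ τ in ζ..t, (1 + sobNorm s (θ τ))) ≤
      Real.exp (C * (T * (1 + M))) := by
    intro ζ hζ
    have h1 : ‖∫ τ in ζ..t, (1 + sobNorm s (θ τ))‖ ≤ (1 + M) * |t - ζ| := by
      refine intervalIntegral.norm_integral_le_of_norm_le_const fun τ hτ => ?_
      rw [uIoc_of_le hζ.2] at hτ
      rw [Real.norm_of_nonneg (by linarith [sobNorm_nonneg s (θ τ)])]
      linarith [hM τ ⟨hζ.1.trans hτ.1.le, hτ.2.trans ht.2⟩]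
    rw [abs_of_nonneg (sub_nonneg.2 hζ.2)] at h1
    have h2 : (1 + M) * (t - ζ) ≤ T * (1 + M) := by
      rw [mul_comm T]
      exact mul_le_mul_of_nonneg_left (by linarith [hζ.1, ht.2]) (by linarith)
    have h3 := (le_abs_self _).trans (h1.trans h2)
    gcongr
  set X := Real.exp (C * (T * (1 + M))) with hX
  have hX0 : 0 < X := Real.exp_pos _
  have hint : ‖∫ ζ in (0 : ℝ)..t, Real.exp (C * ∫ τ in ζ..t, (1 + sobNorm s (θ τ))) *
      sobNorm (2 * α + 1) (θ ζ) ^ 4‖ ≤ X * M ^ 4 * |t - 0| := by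
    refine intervalIntegral.norm_integral_le_of_norm_le_const fun ζ hζ => ?_
    rw [uIoc_of_le ht.1] at hζ
    have hζT : ζ ∈ Icc 0 T := ⟨hζ.1.le, hζ.2.trans ht.2⟩
    have h1 : sobNorm (2 * α + 1) (θ ζ) ≤ M := by
      refine le_trans ?_ (hM ζ hζT)
      rw [sobNorm_eq, sobNorm_eq]
      exact mul_le_mul_of_nonneg_left (hs_mono (by linarith) (by linarith)
        (hθ.memHs ζ hζT).finiteHs) Real.two_pi_pos.le
    have h2 := sobNorm_nonneg (2 * α + 1) (θ ζ)
    rw [Real.norm_of_nonneg (by positivity)]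
    exact mul_le_mul (hexp ζ ⟨hζ.1.le, hζ.2⟩) (pow_le_pow_left₀ h2 h1 4) (by positivity) hX0.le
  have hint' := (le_abs_self _).trans hint
  rw [sub_zero, abs_of_nonneg ht.1] at hint'
  have h3 : X * M ^ 4 * t ≤ X * M ^ 4 * T := mul_le_mul_of_nonneg_left ht.2 (by positivity)
  have h4 : gap μ α θ₀μ θ₀ ≤ |K| * μ ^ 2 :=
    hK.trans (mul_le_mul_of_nonneg_right (le_abs_self K) (sq_nonneg μ))
  refine (gap_le hα₀ hα hα1 hs3 hμ h₀μ h₀ hθμ hθ ht).trans ?_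
  calc _ ≤ |K| * μ ^ 2 * X + C * μ ^ 2 * (X * M ^ 4 * T) := by
        refine add_le_add (mul_le_mul h4 (hexp 0 ⟨le_rfl, ht.1⟩) (Real.exp_pos _).le
          (by positivity)) (mul_le_mul_of_nonneg_left (hint'.trans h3) (by positivity))
    _ ≤ rateConst α₀ T M K * μ ^ 2 := by
        rw [rateConst, ← hC_def, ← hX]
        nlinarith [sq_nonneg μ]

end QG

end

theorem theorem4p3 :
    -- The estimate, with a constant that depends only on a positive lower bound for `α`.
    (∀ α₀ : ℝ, 0 < α₀ → ∃ C : ℝ, 0 < C ∧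
      ∀ α s μ T : ℝ, α₀ ≤ α → α ≤ 1 → 3 ≤ s → 0 < μ → 0 < T →
      ∀ (θ₀μ θ₀ : QG.Box → ℝ) (θμ θ : ℝ → QG.Box → ℝ),
        QG.MemHs s θ₀μ → QG.MemHs s θ₀ →
        QG.IsRegularizedSolution μ α s T θ₀μ θμ → QG.IsQGSolution s T θ₀ θ →
        ∀ t ∈ Set.Icc 0 T,
          QG.gap μ α (θμ t) (θ t) ≤
            QG.gap μ α θ₀μ θ₀ *
                Real.exp (C * ∫ τ in (0 : ℝ)..t, (1 + QG.sobNorm s (θ τ)))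
              + C * μ ^ 2 * ∫ ζ in (0 : ℝ)..t,
                  Real.exp (C * ∫ τ in ζ..t, (1 + QG.sobNorm s (θ τ)))
                    * QG.sobNorm (2 * α + 1) (θ ζ) ^ 4) ∧
    -- Rate `μ²` on every interval on which the solution `θ` exists.
    (∀ α₀ T M K : ℝ, 0 < α₀ → 0 < T → ∃ C : ℝ, 0 < C ∧
      ∀ α s : ℝ, α₀ ≤ α → α ≤ 1 → 3 ≤ s →
      ∀ (θ₀ : QG.Box → ℝ) (θ : ℝ → QG.Box → ℝ),
        QG.MemHs s θ₀ → QG.IsQGSolution s T θ₀ θ →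
        (∀ t ∈ Set.Icc 0 T, QG.sobNorm s (θ t) ≤ M) →
      ∀ (μ₁ : ℝ) (θ₀μ : ℝ → QG.Box → ℝ) (θμ : ℝ → ℝ → QG.Box → ℝ),
        (∀ μ ∈ Set.Ioo 0 μ₁, QG.MemHs s (θ₀μ μ) ∧
          QG.IsRegularizedSolution μ α s T (θ₀μ μ) (θμ μ) ∧
          QG.gap μ α (θ₀μ μ) θ₀ ≤ K * μ ^ 2) →
        ∀ μ ∈ Set.Ioo 0 μ₁, ∀ t ∈ Set.Icc 0 T,
          QG.gap μ α (θμ μ t) (θ t) ≤ C * μ ^ 2) ∧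
    -- Rate `μ²` with a constant controlled by the initial norm alone, on the time interval
    -- that the initial norm guarantees.
    (∀ s : ℝ, 3 ≤ s → ∃ c : ℝ, 0 < c ∧
      ∀ α₀ T R K : ℝ, 0 < α₀ → 0 < T → T * R ≤ c → ∃ C : ℝ, 0 < C ∧
      ∀ α : ℝ, α₀ ≤ α → α ≤ 1 →
      ∀ (θ₀ : QG.Box → ℝ) (θ : ℝ → QG.Box → ℝ),
        QG.MemHs s θ₀ → QG.sobNorm s θ₀ ≤ R → QG.IsQGSolution s T θ₀ θ →
      ∀ (μ₁ : ℝ) (θ₀μ : ℝ → QG.Box → ℝ) (θμ : ℝ → ℝ → QG.Box → ℝ),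
        (∀ μ ∈ Set.Ioo 0 μ₁, QG.MemHs s (θ₀μ μ) ∧
          QG.IsRegularizedSolution μ α s T (θ₀μ μ) (θμ μ) ∧
          QG.gap μ α (θ₀μ μ) θ₀ ≤ K * μ ^ 2) →
        ∀ μ ∈ Set.Ioo 0 μ₁, ∀ t ∈ Set.Icc 0 T,
          QG.gap μ α (θμ μ t) (θ t) ≤ C * μ ^ 2) := by
  refine ⟨fun α₀ hα₀ => ⟨QG.gapConst α₀, one_pos.trans_le (QG.one_le_gapConst α₀), ?_⟩,
    fun α₀ T M K hα₀ hT => ⟨QG.rateConst α₀ T M K, QG.rateConst_pos hT, ?_⟩,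
    fun s hs => ⟨QG.lifespan s, QG.lifespan_pos (by linarith), fun α₀ T R K hα₀ hT hTR =>
      ⟨QG.rateConst α₀ T (2 * Real.pi * (2 * (QG.lifespan s / T))) K, QG.rateConst_pos hT, ?_⟩⟩⟩
  · intro α s μ T hα hα1 hs hμ _ θ₀μ θ₀ θμ θ h₀μ h₀ hθμ hθ t ht
    exact QG.gap_le hα₀ hα hα1 hs hμ h₀μ h₀ hθμ hθ ht
  · intro α s hα hα1 hs θ₀ θ h₀ hθ hM μ₁ θ₀μ θμ hμ μ hμ₁ t ht
    obtain ⟨h₀μ, hθμ, hK⟩ := hμ μ hμ₁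
    exact QG.gap_le_rate hα₀ hα hα1 hs hμ₁.1 h₀μ h₀ hθμ hθ hM hK ht
  · intro α hα hα1 θ₀ θ h₀ hR hθ μ₁ θ₀μ θμ hμ μ hμ₁ t ht
    obtain ⟨h₀μ, hθμ, hK⟩ := hμ μ hμ₁
    exact QG.gap_le_rate hα₀ hα hα1 hs hμ₁.1 h₀μ h₀ hθμ hθ
      (fun t ht => hθ.sobNorm_le hs hT hTR hR ht) hK ht
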